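/- **Conventions.** A loop is Moufang if $((xy)x)z=x(y(xz))$ for all $x,y,z$. The commutator $[x,y]$ and the associator $[x,y,z]$ are defined by $xy=(yx)[x,y]$ and $(xy)z=(x(yz))[x,y,z]$. $Z(G)$ is the center of $G$ and $N(G)$ is its nucleus. The associators of loops $G$ and $L$ are *equivalent* if there are bijections $\varphi,\psi:G\to L$ with $\psi([x,y,z])=[\varphi(x),\varphi(y),\varphi(z)]$ for all $x,y,z\in G$. Let $F=GF(2)$. For a vector space $V$ over $F$ and $f:V\to F$ with $f(0)=0$, the $n$th derived form is $f_n(v_1,\dots,v_n)=\sum_{\emptyset\ne I\subseteq\{1,\dots,n\}}f\left(\sum_{i\in I}v_i\right)$, and $\operatorname{cdeg} f$ is the least $n\ge 0$ with $f_{n+1}=0$. A *code loop* is a finite loop $G$ with a central subloop $Z$ of order $2$ such that $V=G/Z$ is an elementary abelian $2$-group and, after identifying $Z$ with $F$, the power map $P:V\to F$, $P(aZ)=a^2$, satisfies $\operatorname{cdeg} P\le 3$, $[a,b]=P_2(aZ,bZ)$ and $[a,b,c]=P_3(aZ,bZ,cZ)$ for all $a,b,c\in G$. It has *trivial radical* if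 $0$ is the only $u\in V$ with $P_3(u,v,w)=0$ for all $v,w\in V$. For an integer $m\ge1$ let $M=\{-m+1,\dots,m\}$, and for $i\in\mathbb Z$ let $\sigma(i)=1$ if $i>m$, $\sigma(i)=0$ if $i\in M$, and $\sigma(i)=-1$ if $i<1-m$. *Condition (C)* on $(G,S,\alpha,h)$: $G$ is a Moufang loop, $S\unlhd G$, $G/S=\langle\alpha\rangle$ is a cyclic group of order $2m$, and $1\ne h\in S\cap Z(G)$. The *cyclic construction* then defines $(G,*)$ by $x*y=(xy)h^{\sigma(i+j)}$ for $x\in\alpha^i$, $y\in\alpha^j$, $i,j\in M$. *Condition (D)* on $(G,S,\beta,\gamma,h)$: $G$ is a Moufang loop, $S\unlhd G$, $G/S$ is a dihedral group of order $4m$ (the Klein four-group if $m=1$), $\beta,\gamma$ are involutions of $G/S$ such that $\alpha=\beta\gamma$ has order $2m$, and, with $G_0=\bigcup_{i\in M}\alpha^i$ and $G_1=G\setminus G_0$, $1\ne h\in S\cap Z(G_0)\cap N(G)$ and $hxh=x$ for some $x\in G_1$. The *dihedral construction* then defines $(G,*)$, for any $e\in\beta$ and $f\in\gamma$, by $x*y=(xy)h^{(-1)^r\sigma(i+j)}$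 for $x\in\alpha^i\cup e\alpha^i$, $y\in(\alpha^j\cup\alpha^jf)\cap G_r$, $i,j\in M$, $r\in\{0,1\}$. **Theorem.** 1. Let $G$ be a code loop with trivial radical, and suppose that $(G,S,\alpha,h)$ satisfies (C) or that $(G,S,\beta,\gamma,h)$ satisfies (D). Then $G/S$ is isomorphic to $C_2$ or $V_4$. The resulting $(G,*)$ is a code loop with trivial radical, and the associators of $G$ and $(G,*)$ are equivalent; in fact they coincide as maps $G\times G\times G\to G$. 2. Every Moufang loop whose associator is equivalent to the associator of a code loop with trivial radical is itself a code loop with trivial radical. 3. Any two code loops $G$ and $L$ (with trivial radical or not) whose associators are equivalent are connected by the two constructions: there is a finite sequence of loops $G=H_0,H_1,\dots,H_s\cong L$ ($s\ge 0$) in which each $H_{i+1}$ is obtained from $H_i$ by the cyclic or the dihedral construction. -/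

import Mathlib

universe u v

/-- A loop with underlying set `G`: a binary operation with a two-sided neutral element all of whose
left and right translations are bijections. -/
structure LoopOn (G : Type u) where
  /-- the multiplication -/
  mul : G → G → G
  /-- the neutral element -/
  one : G
  one_mul : ∀ x, mul one x = x
  mul_one : ∀ x, mul x one = x
  bijective_left : ∀ a, Function.Bijective (fun x => mul a x)
  bijective_right : ∀ a, Function.Bijective (fun x => mul x a)

namespace LoopOn

variable {G : Type u} (L : LoopOn G)

/-- Left division: the unique `w` with `a w = b`. -/
noncomputable def ldiv (a b : G) : G := Classical.choose ((L.bijective_left a).2 b)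

theorem mul_ldiv (a b : G) : L.mul a (L.ldiv a b) = b :=
  Classical.choose_spec ((L.bijective_left a).2 b)

/-- Right division: the unique `w` with `w a = b`. -/
noncomputable def rdiv (b a : G) : G := Classical.choose ((L.bijective_right a).2 b)

theorem rdiv_mul (b a : G) : L.mul (L.rdiv b a) a = b :=
  Classical.choose_spec ((L.bijective_right a).2 b)

/-- The inverse of `a`, i.e. the unique `w` with `a w = 1`. -/
noncomputable def inv (a : G) : G := L.ldiv a L.one

/-- The powers `a ^ 0 = 1` and `a ^ (n + 1) = a ^ n · a`. -/
def npow (a : G) : ℕ → G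
  | 0 => L.one
  | n + 1 => L.mul (npow a n) a

/-- Integer powers. -/
noncomputable def zpow (a : G) : ℤ → G
  | Int.ofNat n => L.npow a n
  | Int.negSucc n => L.inv (L.npow a (n + 1))

/-- The element `a` has (finite) order `n`. -/
def HasOrder (a : G) (n : ℕ) : Prop :=
  0 < n ∧ L.npow a n = L.one ∧ ∀ k, 0 < k → k < n → L.npow a k ≠ L.one

/-- The Moufang identity `((xy)x)z = x(y(xz))`. -/
def IsMoufang : Prop :=
  ∀ x y z, L.mul (L.mul (L.mul x y) x) z = L.mul x (L.mul y (L.mul x z))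

def IsAssoc : Prop := ∀ x y z, L.mul (L.mul x y) z = L.mul x (L.mul y z)

/-- The commutator `[x, y]`: the unique `w` with `xy = (yx)w`. -/
noncomputable def commutator (x y : G) : G := L.ldiv (L.mul y x) (L.mul x y)

/-- The associator `[x, y, z]`: the unique `w` with `(xy)z = (x(yz))w`. -/
noncomputable def associator (x y z : G) : G :=
  L.ldiv (L.mul x (L.mul y z)) (L.mul (L.mul x y) z)

/-- The elements of `T` that associate, in every position, with all pairs of elements of `T`. -/
def nucleusOf (T : Set G) : Set G :=
  {a | a ∈ T ∧ ∀ x ∈ T, ∀ y ∈ T,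
    L.mul (L.mul a x) y = L.mul a (L.mul x y) ∧
    L.mul (L.mul x a) y = L.mul x (L.mul a y) ∧
    L.mul (L.mul x y) a = L.mul x (L.mul y a)}

/-- The center of (the subloop with underlying set) `T`: the elements of `T` that commute and
associate with all elements of `T`. -/
def centerOf (T : Set G) : Set G :=
  {a | a ∈ L.nucleusOf T ∧ ∀ x ∈ T, L.mul a x = L.mul x a}

/-- The nucleus `N(G)`. -/
def nucleus : Set G := L.nucleusOf Set.univ

/-- The center `Z(G)`. -/
def center : Set G := L.centerOf Set.univ

/-- Two loops are isomorphic. -/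
def Iso {H : Type v} (K : LoopOn H) : Prop :=
  ∃ f : G ≃ H, ∀ x y, f (L.mul x y) = K.mul (f x) (f y)

/-- The loop is isomorphic to the group `K`. -/
def IsoGroup (K : Type v) [Group K] : Prop :=
  ∃ f : G ≃ K, ∀ x y, f (L.mul x y) = f x * f y

/-- The associators of two loops are equivalent as ternary maps: up to bijections of the arguments
and of the values they are the same map. -/
def AssociatorEquiv {H : Type v} (K : LoopOn H) : Prop :=
  ∃ (φ : G ≃ H) (ψ : G ≃ H), ∀ x y z,
    ψ (L.associator x y z) = K.associator (φ x) (φ y) (φ z)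

end LoopOn

/-- A normal subloop `S`: closed under the operations of the loop, and with
`xS = Sx`, `x(yS) = (xy)S`, `(Sx)y = S(xy)` for all `x`, `y`. -/
structure NormalSubloop {G : Type u} (L : LoopOn G) where
  carrier : Set G
  one_mem : L.one ∈ carrier
  mul_mem : ∀ a ∈ carrier, ∀ b ∈ carrier, L.mul a b ∈ carrier
  ldiv_mem : ∀ a ∈ carrier, ∀ b ∈ carrier, L.ldiv a b ∈ carrier
  rdiv_mem : ∀ a ∈ carrier, ∀ b ∈ carrier, L.rdiv a b ∈ carrier
  coset_comm : ∀ x, (fun s => L.mul x s) '' carrier = (fun s => L.mul s x) '' carrier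
  coset_left : ∀ x y,
    (fun s => L.mul x (L.mul y s)) '' carrier = (fun s => L.mul (L.mul x y) s) '' carrier
  coset_right : ∀ x y,
    (fun s => L.mul (L.mul s x) y) '' carrier = (fun s => L.mul s (L.mul x y)) '' carrier

namespace NormalSubloop

variable {G : Type u} {L : LoopOn G} (S : NormalSubloop L)

/-- The coset `xS`. -/
def coset (x : G) : Set G := (fun s => L.mul x s) '' S.carrier

/-- Two elements are equivalent if their cosets are equal. -/
def setoid : Setoid G := Setoid.ker S.coset

/-- The set `G/S` of cosets. -/
def Quot : Type u := Quotient S.setoid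

/-- The projection `G → G/S`. -/
def proj (x : G) : S.Quot := Quotient.mk S.setoid x

theorem proj_eq {x y : G} : S.proj x = S.proj y ↔ S.coset x = S.coset y :=
  ⟨fun h => Quotient.exact h, fun h => Quotient.sound (s := S.setoid) h⟩

theorem mem_coset_self (x : G) : x ∈ S.coset x := ⟨L.one, S.one_mem, L.mul_one x⟩

theorem coset_mul_left (a : G) {x y : G} :
    S.coset (L.mul a x) = S.coset (L.mul a y) ↔ S.coset x = S.coset y := by
  have key : ∀ t, S.coset (L.mul a t) = (fun s => L.mul a s) '' S.coset t := by
    intro t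
    rw [coset, ← S.coset_left a t, coset, Set.image_image]
  rw [key, key]
  exact (Set.image_injective.2 (L.bijective_left a).1).eq_iff

theorem coset_mul_right (a : G) {x y : G} :
    S.coset (L.mul x a) = S.coset (L.mul y a) ↔ S.coset x = S.coset y := by
  have key : ∀ t, S.coset (L.mul t a) = (fun s => L.mul s a) '' S.coset t := by
    intro t
    rw [coset, S.coset_comm, ← S.coset_right t a, coset, S.coset_comm t, Set.image_image]
  rw [key, key]
  exact (Set.image_injective.2 (L.bijective_right a).1).eq_iff

/-- The multiplication `(xS)(yS) = (xy)S` of cosets. -/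
def quotMul : S.Quot → S.Quot → S.Quot :=
  Quotient.lift₂ (fun x y => S.proj (L.mul x y)) (by
    intro a b a' b' h h'
    have h1 : S.coset a = S.coset a' := h
    have h2 : S.coset b = S.coset b' := h'
    exact S.proj_eq.2 (((S.coset_mul_right b).2 h1).trans ((S.coset_mul_left a').2 h2)))

theorem quotMul_proj (x y : G) : S.quotMul (S.proj x) (S.proj y) = S.proj (L.mul x y) := rfl

theorem exists_proj (q : S.Quot) : ∃ x, S.proj x = q := Quotient.exists_rep q

/-- The quotient loop `G/S`. -/
def quotient : LoopOn S.Quot where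
  mul := S.quotMul
  one := S.proj L.one
  one_mul := by
    intro q
    obtain ⟨x, rfl⟩ := S.exists_proj q
    rw [quotMul_proj, L.one_mul]
  mul_one := by
    intro q
    obtain ⟨x, rfl⟩ := S.exists_proj q
    rw [quotMul_proj, L.mul_one]
  bijective_left := by
    intro p
    obtain ⟨a, rfl⟩ := S.exists_proj p
    constructor
    · intro q r
      obtain ⟨x, rfl⟩ := S.exists_proj q
      obtain ⟨y, rfl⟩ := S.exists_proj r
      intro h
      exact S.proj_eq.2 ((S.coset_mul_left a).1 (S.proj_eq.1 h))
    · intro q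
      obtain ⟨b, rfl⟩ := S.exists_proj q
      exact ⟨S.proj (L.ldiv a b), congrArg S.proj (L.mul_ldiv a b)⟩
  bijective_right := by
    intro p
    obtain ⟨a, rfl⟩ := S.exists_proj p
    constructor
    · intro q r
      obtain ⟨x, rfl⟩ := S.exists_proj q
      obtain ⟨y, rfl⟩ := S.exists_proj r
      intro h
      exact S.proj_eq.2 ((S.coset_mul_right a).1 (S.proj_eq.1 h))
    · intro q
      obtain ⟨b, rfl⟩ := S.exists_proj q
      exact ⟨S.proj (L.rdiv b a), congrArg S.proj (L.rdiv_mul b a)⟩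

end NormalSubloop

/-- The set `M = {-m+1, ..., m}` of exponents. -/
def exponentSet (m : ℕ) : Set ℤ := Set.Icc (1 - (m : ℤ)) m

/-- `σ(i) = 1` if `i > m`, `σ(i) = 0` if `i ∈ M`, and `σ(i) = -1` if `i < 1 - m`. -/
def sigma (m : ℕ) (i : ℤ) : ℤ :=
  if (m : ℤ) < i then 1 else if i < 1 - (m : ℤ) then -1 else 0

namespace LoopOn

variable {G : Type u} (L : LoopOn G)

/-- The condition (C) on `(G, S, α, h)`, where `G/S = ⟨α⟩` is a cyclic group of order `2m`. -/
structure CondC (S : NormalSubloop L) (m : ℕ) (α : S.Quot) (h : G) : Prop where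
  moufang : L.IsMoufang
  m_pos : 0 < m
  assoc : S.quotient.IsAssoc
  generates : ∀ q : S.Quot, ∃ i : ℤ, q = S.quotient.zpow α i
  card : Nat.card S.Quot = 2 * m
  h_ne_one : h ≠ L.one
  h_mem : h ∈ S.carrier
  h_center : h ∈ L.center

/-- `K` is the loop `(G, *)` of the cyclic construction:
`x * y = (xy) h ^ σ(i + j)` for `x ∈ α ^ i`, `y ∈ α ^ j`, `i, j ∈ M`. -/
def IsCyclicResult (S : NormalSubloop L) (m : ℕ) (α : S.Quot) (h : G) (K : LoopOn G) : Prop :=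
  ∀ i ∈ exponentSet m, ∀ j ∈ exponentSet m, ∀ x y : G,
    S.proj x = S.quotient.zpow α i → S.proj y = S.quotient.zpow α j →
      K.mul x y = L.mul (L.mul x y) (L.zpow h (sigma m (i + j)))

/-- The union `G₀` of the cosets `α ^ i`, `i ∈ M`, where `α = βγ`. -/
def dihedralG0 (S : NormalSubloop L) (m : ℕ) (β γ : S.Quot) : Set G :=
  {x | ∃ i ∈ exponentSet m, S.proj x = S.quotient.zpow (S.quotient.mul β γ) i}

/-- The condition (D) on `(G, S, β, γ, h)`, where `G/S` is a dihedral group of order `4m`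
(the Klein four-group if `m = 1`). The order of `DihedralGroup k` is `2k`. -/
structure CondD (S : NormalSubloop L) (m : ℕ) (β γ : S.Quot) (h : G) : Prop where
  moufang : L.IsMoufang
  m_pos : 0 < m
  dihedral : S.quotient.IsoGroup (DihedralGroup (2 * m))
  beta_order : S.quotient.HasOrder β 2
  gamma_order : S.quotient.HasOrder γ 2
  alpha_order : S.quotient.HasOrder (S.quotient.mul β γ) (2 * m)
  h_ne_one : h ≠ L.one
  h_mem : h ∈ S.carrier
  h_center : h ∈ L.centerOf (L.dihedralG0 S m β γ)
  h_nucleus : h ∈ L.nucleus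
  h_inverts : ∃ x, x ∉ L.dihedralG0 S m β γ ∧ L.mul (L.mul h x) h = x

/-- `K` is the loop `(G, *)` of the dihedral construction, with `α = βγ`:
`x * y = (xy) h ^ ((-1) ^ r σ(i + j))` for `x ∈ α ^ i ∪ eα ^ i`, `y ∈ (α ^ j ∪ α ^ j f) ∩ G_r`,
`i, j ∈ M`, where `G₁ = G \ G₀`. For `e ∈ β` and `f ∈ γ` the sets `eα ^ i` and `α ^ j f` are
the cosets `βα ^ i` and `α ^ j γ`. -/
def IsDihedralResult (S : NormalSubloop L) (m : ℕ) (β γ : S.Quot) (h : G) (K : LoopOn G) : Prop :=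
  ∀ i ∈ exponentSet m, ∀ j ∈ exponentSet m, ∀ x y : G,
    (S.proj x = S.quotient.zpow (S.quotient.mul β γ) i ∨
      S.proj x = S.quotient.mul β (S.quotient.zpow (S.quotient.mul β γ) i)) →
    (S.proj y = S.quotient.zpow (S.quotient.mul β γ) j ∨
      S.proj y = S.quotient.mul (S.quotient.zpow (S.quotient.mul β γ) j) γ) →
    (y ∈ L.dihedralG0 S m β γ →
      K.mul x y = L.mul (L.mul x y) (L.zpow h (sigma m (i + j)))) ∧
    (y ∉ L.dihedralG0 S m β γ →
      K.mul x y = L.mul (L.mul x y) (L.zpow h (-sigma m (i + j))))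

/-- `K` is obtained from `L` by one application of the cyclic or of the dihedral construction. -/
def Step (K : LoopOn G) : Prop :=
  (∃ (S : NormalSubloop L) (m : ℕ) (α : S.Quot) (h : G),
    L.CondC S m α h ∧ L.IsCyclicResult S m α h K) ∨
  (∃ (S : NormalSubloop L) (m : ℕ) (β γ : S.Quot) (h : G),
    L.CondD S m β γ h ∧ L.IsDihedralResult S m β γ h K)

end LoopOn

/-- The `n`-th derived form of `f`: the sum of `f (∑ i ∈ s, v i)` over all nonempty sets `s` of
indices. -/
def derivedForm {V : Type u} [AddCommMonoid V] (f : V → ZMod 2) (n : ℕ) (w : Fin n → V) : ZMod 2 :=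
  ∑ s ∈ (Finset.univ : Finset (Finset (Fin n))).erase ∅, f (∑ i ∈ s, w i)

/-- The combinatorial degree of `f`, the least `n` with `f_{n+1} = 0`, is at most `d`. -/
def CdegLE {V : Type u} [AddCommMonoid V] (f : V → ZMod 2) (d : ℕ) : Prop :=
  ∃ n ≤ d, ∀ w : Fin (n + 1) → V, derivedForm f (n + 1) w = 0

/-- The radical of the third derived form `f_3`. -/
def radical3 {V : Type u} [AddCommMonoid V] (f : V → ZMod 2) : Set V :=
  {a | ∀ b c : V, derivedForm f 3 ![a, b, c] = 0}

namespace LoopOn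

variable {G : Type u} (L : LoopOn G)

open Classical in
/-- On a central subloop `Z` of order two this is the isomorphism of `Z` with `F = {0, 1}`. -/
noncomputable def toF (g : G) : ZMod 2 := if g = L.one then 0 else 1

/-- `L` is symplectic: `Z` is a central subloop of order two, and `e` identifies `G/Z` with the
vector space `V = F ^ n`. -/
structure IsSymplecticWith (Z : NormalSubloop L) (n : ℕ) (e : Z.Quot ≃ (Fin n → ZMod 2)) :
    Prop where
  central : Z.carrier ⊆ L.center
  card : Nat.card Z.carrier = 2
  map_mul : ∀ p q, e (Z.quotient.mul p q) = e p + e q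

/-- `L` is a code loop `(V, F, P)` with respect to the identifications of `Z` with `F` and of `G/Z`
with `V = F ^ n`: the power map is `P`, `cdeg P ≤ 3`, the commutator map is `P_2`, and the
associator map is `P_3`. -/
structure IsCodeWith (Z : NormalSubloop L) (n : ℕ) (e : Z.Quot ≃ (Fin n → ZMod 2))
    (P : (Fin n → ZMod 2) → ZMod 2) : Prop where
  symplectic : L.IsSymplecticWith Z n e
  power : ∀ x, P (e (Z.proj x)) = L.toF (L.mul x x)
  cdeg_le : CdegLE P 3
  commutator_eq : ∀ x y, L.toF (L.commutator x y) = derivedForm P 2 ![e (Z.proj x), e (Z.proj y)]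
  associator_eq : ∀ x y z,
    L.toF (L.associator x y z) = derivedForm P 3 ![e (Z.proj x), e (Z.proj y), e (Z.proj z)]

/-- `L` is a (finite) code loop. -/
def IsCodeLoop : Prop :=
  ∃ (Z : NormalSubloop L) (n : ℕ) (e : Z.Quot ≃ (Fin n → ZMod 2))
    (P : (Fin n → ZMod 2) → ZMod 2), L.IsCodeWith Z n e P

/-- `L` is a code loop such that the radical of `P_3` is the zero subspace of `V`. -/
def IsCodeLoopTrivialRadical : Prop :=
  ∃ (Z : NormalSubloop L) (n : ℕ) (e : Z.Quot ≃ (Fin n → ZMod 2))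
    (P : (Fin n → ZMod 2) → ZMod 2), L.IsCodeWith Z n e P ∧ radical3 P = {0}

end LoopOn

-- A code loop is a central extension of V by F = GF(2) whose squares, commutators and associators
-- are P and its polarizations `polar P` and `polar3 P`; `IsCode` records this with an action `s` of
-- F on the loop. The form `polar3 P` is symmetric, trilinear and alternating, and every code loop
-- is Moufang.
--
-- Recognition (assertion 2). Transport V to the second loop K by q = p ∘ φ⁻¹, a map that a priori
-- is not a homomorphism. The associator of K is then c(B(qx, qy, qz)) with B = `polar3 P`
-- nondegenerate. The partner ν of 1 in its q-fibre associates with everything, and nondegeneracy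
-- forces ν to be a central involution whose cosets are the fibres; an inner-mapping argument gives
-- c(1) = ν. Reassociating four factors then yields a cocycle identity which, with the symmetry of
-- B, makes q a homomorphism. Squaring on K defines a new power map, and the Moufang identities show
-- that its polarizations are the commutator and the associator.
--
-- Single constructions (assertion 1). Trivial radical forces h to be the nontrivial element of Z.
-- Since h lies in S, the quotient G/S is elementary abelian, hence m = 1, and σ(i + j) becomes ij
-- for i, j in {0, 1}. Both constructions multiply xy by h^(t(x)t'(y)) with t, t' additive on G/S (t
-- = t' in the cyclic case). Such a biadditive twist changes both bracketings of a product equally,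
-- so it preserves associators and the Moufang identity, and recognition applies.
--
-- Connectivity (assertion 3). The bijection φ need not be linear, but comparing the linear maps
-- that send v to the form B(v, ·, ·) gives a linear automorphism e carrying one third derived form
-- to the other. Hence P + P' ∘ e has zero third derived form and is a sum of monomials v_i v_j.
-- Adding v_i² to P is a cyclic step, adding v_i v_j with i ≠ j a dihedral step. Finally, the power
-- map determines a code loop up to isomorphism: the cocycles of two such loops differ by a
-- symmetric alternating cocycle, whose extension is a vector space and therefore splits.

universe w

/-! ### Inverse property and Moufang identities -/

namespace LoopOn

variable {G : Type u} {L : LoopOn G}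

theorem mul_left_cancel {a x y : G} (h : L.mul a x = L.mul a y) : x = y := (L.bijective_left a).1 h

theorem mul_right_cancel {a x y : G} (h : L.mul x a = L.mul y a) : x = y :=
  (L.bijective_right a).1 h

theorem ldiv_eq {a b c : G} (h : L.mul a c = b) : L.ldiv a b = c :=
  mul_left_cancel ((L.mul_ldiv a b).trans h.symm)

theorem mul_associator (x y z : G) :
    L.mul (L.mul x (L.mul y z)) (L.associator x y z) = L.mul (L.mul x y) z := L.mul_ldiv _ _

theorem mul_inv_self (x : G) : L.mul x (L.inv x) = L.one := L.mul_ldiv _ _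

namespace IsMoufang

variable (hL : L.IsMoufang)
include hL

theorem flexible (x y : G) : L.mul (L.mul x y) x = L.mul x (L.mul y x) := by
  have h := hL x y L.one
  rwa [L.mul_one, L.mul_one] at h

theorem inv_mul_cancel_left (x z : G) : L.mul (L.inv x) (L.mul x z) = z := by
  have h := hL x (L.inv x) z
  rw [mul_inv_self, L.one_mul] at h
  exact (mul_left_cancel h).symm

theorem inv_mul_self (x : G) : L.mul (L.inv x) x = L.one := by
  have h := hL.inv_mul_cancel_left x L.one
  rwa [L.mul_one] at h

theorem mul_inv_cancel_left (x z : G) : L.mul x (L.mul (L.inv x) z) = z :=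
  mul_left_cancel (a := L.inv x) (hL.inv_mul_cancel_left x _)

theorem mul_inv_cancel_right (u x : G) : L.mul (L.mul u x) (L.inv x) = u := by
  have h := hL x (L.mul (L.inv x) u) (L.inv x)
  rw [mul_inv_self, L.mul_one, hL.mul_inv_cancel_left] at h
  exact h

theorem inv_mul_cancel_right (u x : G) : L.mul (L.mul u (L.inv x)) x = u :=
  mul_right_cancel (L := L) (a := L.inv x) (hL.mul_inv_cancel_right _ x)

theorem inv_inv (x : G) : L.inv (L.inv x) = x :=
  mul_left_cancel (a := L.inv x) ((mul_inv_self _).trans (hL.inv_mul_self x).symm)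

theorem inv_mul (x y : G) : L.inv (L.mul x y) = L.mul (L.inv y) (L.inv x) := by
  have h1 := hL.mul_inv_cancel_right x y
  have h2 := hL.inv_mul_cancel_left (L.mul x y) (L.inv y)
  rw [h1] at h2
  rw [← h2, hL.mul_inv_cancel_right]

theorem right_moufang (x y z : G) :
    L.mul (L.mul (L.mul z x) y) x = L.mul z (L.mul x (L.mul y x)) := by
  have h := congrArg L.inv (hL (L.inv x) (L.inv y) (L.inv z))
  simpa only [hL.inv_mul, hL.inv_inv] using h.symm

theorem middle_moufang (x y z : G) :
    L.mul (L.mul x y) (L.mul z x) = L.mul (L.mul x (L.mul y z)) x := by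
  refine mul_right_cancel (L := L) (a := L.inv x) ?_
  have h := hL.right_moufang (L.inv x) (L.mul z x) (L.mul (L.mul x y) x)
  rw [hL.mul_inv_cancel_right, hL.mul_inv_cancel_right] at h
  rw [hL.mul_inv_cancel_right, h, hL, hL.mul_inv_cancel_left]

/-- The inner mapping `w ↦ x` with `y(zx) = (yz)w` is given by the associator. -/
theorem mul_associator_of_eq {x y z w : G} (h : L.mul y (L.mul z x) = L.mul (L.mul y z) w) :
    L.mul w (L.associator x y z) = x := by
  suffices hc : L.associator x y z = L.mul (L.inv w) x by rw [hc, hL.mul_inv_cancel_left]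
  refine ldiv_eq ?_
  set p := L.mul y z with hp
  have hy : y = L.mul p (L.inv z) := (hL.mul_inv_cancel_right y z).symm
  set u := L.mul z x with hu
  have hz : z = L.mul u (L.inv x) := (hL.mul_inv_cancel_right z x).symm
  set W := L.mul p (L.inv u) with hW
  have hpW : p = L.mul W u := (hL.inv_mul_cancel_right p u).symm
  have hw : w = L.mul (L.inv p) (L.mul y u) := by rw [h, hL.inv_mul_cancel_left]
  -- Rewriting p w⁻¹ as W z allows x((yz)w⁻¹)x to be regrouped by the middle Moufang identity as
  -- (xW)(zx) = (xW)u.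
  have hwinv : L.mul p (L.inv w) = L.mul W z := by
    rw [hw, hL.inv_mul, hL.inv_mul y u, hL.inv_inv, hy, hL.inv_mul p, hL.inv_inv, ← hL.flexible,
      ← hL.middle_moufang, hL.inv_mul_cancel_right]
  rw [hL.middle_moufang, hwinv, ← hL.middle_moufang, ← hu]
  set s := L.mul x (L.inv u) with hs
  have hx : x = L.mul s u := (hL.inv_mul_cancel_right x u).symm
  have hzs : L.inv z = s := by rw [hz, hL.inv_mul, hL.inv_inv]
  refine mul_right_cancel (L := L) (a := L.inv z) ?_
  rw [hL.mul_inv_cancel_right, hzs, hy, hzs, hpW]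
  conv_lhs => rw [hx]
  conv_rhs => rw [hx]
  rw [hL.right_moufang, hL.middle_moufang]

end IsMoufang

end LoopOn

/-! ### Derived forms of small order -/

theorem ZMod.two_add_self (a : ZMod 2) : a + a = 0 := CharTwo.add_self_eq_zero a

section DerivedForm

variable {V : Type w} [AddCommMonoid V]

/-- The second derived form, expanded. -/
def polar (P : V → ZMod 2) (a b : V) : ZMod 2 := P (a + b) + P a + P b

/-- The third derived form, expanded. -/
def polar3 (P : V → ZMod 2) (a b c : V) : ZMod 2 :=
  P (a + b + c) + P (a + b) + P (a + c) + P (b + c) + P a + P b + P c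

theorem derivedForm_one (P : V → ZMod 2) (x : Fin 1 → V) : derivedForm P 1 x = P (x 0) := by
  have h : (Finset.univ : Finset (Finset (Fin 1))).erase ∅ = {{0}} := by decide
  rw [derivedForm, h]
  simp

theorem derivedForm_two (P : V → ZMod 2) (x : Fin 2 → V) :
    derivedForm P 2 x = polar P (x 0) (x 1) := by
  have h : (Finset.univ : Finset (Finset (Fin 2))).erase ∅ = {{0, 1}, {0}, {1}} := by decide
  rw [derivedForm, h, Finset.sum_insert (by decide), Finset.sum_insert (by decide)]
  simp [polar]
  ring

theorem derivedForm_three (P : V → ZMod 2) (x : Fin 3 → V) :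
    derivedForm P 3 x = polar3 P (x 0) (x 1) (x 2) := by
  have h : (Finset.univ : Finset (Finset (Fin 3))).erase ∅ =
      {{0, 1, 2}, {0, 1}, {0, 2}, {1, 2}, {0}, {1}, {2}} := by decide
  rw [derivedForm, h]
  repeat rw [Finset.sum_insert (by decide)]
  simp [polar3, add_assoc]

/-- The fourth derived form is the additivity defect of the third, so its vanishing is trilinearity
of `polar3 P`. -/
theorem derivedForm_four (P : V → ZMod 2) (x : Fin 4 → V) :
    derivedForm P 4 x =
      polar3 P (x 0 + x 1) (x 2) (x 3) + polar3 P (x 0) (x 2) (x 3) +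
        polar3 P (x 1) (x 2) (x 3) := by
  have h : (Finset.univ : Finset (Finset (Fin 4))).erase ∅ =
      {{0, 1, 2, 3}, {0, 1, 2}, {0, 1, 3}, {0, 2, 3}, {1, 2, 3}, {0, 1}, {0, 2}, {0, 3}, {1, 2},
        {1, 3}, {2, 3}, {0}, {1}, {2}, {3}} := by decide
  rw [derivedForm, h]
  repeat rw [Finset.sum_insert (by decide)]
  simp [polar3, ← add_assoc]
  linear_combination - ZMod.two_add_self (P (x 2 + x 3)) - ZMod.two_add_self (P (x 2)) -
    ZMod.two_add_self (P (x 3))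

variable {P : V → ZMod 2}

theorem polar3_swap_left (a b c : V) : polar3 P b a c = polar3 P a b c := by
  simp only [polar3, add_comm b a]; ring

theorem polar3_swap_right (a b c : V) : polar3 P a c b = polar3 P a b c := by
  simp only [polar3, add_comm c b, add_right_comm a c b]; ring

theorem polar3_rotate (a b c : V) : polar3 P b c a = polar3 P a b c := by
  rw [polar3_swap_right, polar3_swap_left]

theorem polar3_eq (a b c : V) : polar3 P a b c = polar P (a + b) c + polar P a c + polar P b c := by
  simp only [polar3, polar]
  linear_combination - ZMod.two_add_self (P c)

theorem polar3_zero_left (h : P 0 = 0) (b c : V) : polar3 P 0 b c = 0 := by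
  simp only [polar3, zero_add, h]
  linear_combination ZMod.two_add_self (P (b + c)) + ZMod.two_add_self (P b + P c)

/-- `CdegLE` only gives some vanishing derived form of order at most four. Each derived form is
built from the preceding ones, so vanishing at a lower order makes `polar3 P` zero. -/
theorem CdegLE.polar3_add (h : CdegLE P 3) (a b c d : V) :
    polar3 P (a + b) c d = polar3 P a c d + polar3 P b c d := by
  obtain ⟨n, hn, h⟩ := h
  interval_cases n
  · have hP : ∀ x, P x = 0 := fun x => by simpa [derivedForm_one] using h ![x]
    simp [polar3, hP]
  · have hP : ∀ x y, polar P x y = 0 := fun x y => by simpa [derivedForm_two] using h ![x, y]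
    simp [polar3_eq, hP]
  · have hP : ∀ x y z, polar3 P x y z = 0 := fun x y z => by
      simpa [derivedForm_three] using h ![x, y, z]
    simp [hP]
  · have hP : derivedForm P 4 ![a, b, c, d] = 0 := h _
    rw [derivedForm_four] at hP
    simp only [Matrix.cons_val] at hP
    linear_combination hP - ZMod.two_add_self (polar3 P a c d) -
      ZMod.two_add_self (polar3 P b c d)

theorem cdegLE_of_polar3_add
    (h : ∀ a b c d, polar3 P (a + b) c d = polar3 P a c d + polar3 P b c d) : CdegLE P 3 :=
  ⟨3, le_rfl, fun x => by
    rw [derivedForm_four, h]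
    linear_combination ZMod.two_add_self (polar3 P (x 0) (x 2) (x 3)) +
      ZMod.two_add_self (polar3 P (x 1) (x 2) (x 3))⟩

theorem mem_radical3 {a : V} : a ∈ radical3 P ↔ ∀ b c, polar3 P a b c = 0 := by
  simp [radical3, derivedForm_three]

end DerivedForm

/-! ### Central extensions by the field of two elements -/

namespace LoopOn

variable {G : Type u} {V : Type w} [AddCommGroup V]

/-- `L` is a central extension of the group `V` by `ZMod 2`, which acts on `L` by `s`. -/
structure IsExt (L : LoopOn G) (p : G → V) (s : ZMod 2 → G → G) : Prop where
  smul_mul : ∀ a x y, L.mul (s a x) y = s a (L.mul x y)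
  mul_smul : ∀ a x y, L.mul x (s a y) = s a (L.mul x y)
  smul_smul : ∀ a b x, s a (s b x) = s (a + b) x
  zero_smul : ∀ x, s 0 x = x
  free : ∀ a b x, s a x = s b x → a = b
  surj : Function.Surjective p
  map_mul : ∀ x y, p (L.mul x y) = p x + p y
  map_smul : ∀ a x, p (s a x) = p x
  fiber : ∀ x y, p x = p y → ∃ a, y = s a x

/-- `L` is the code loop with power map `P`. -/
structure IsCode (L : LoopOn G) (p : G → V) (s : ZMod 2 → G → G) (P : V → ZMod 2) : Prop
    extends L.IsExt p s where
  sq : ∀ x, L.mul x x = s (P (p x)) L.one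
  comm : ∀ x y, L.mul x y = s (polar P (p x) (p y)) (L.mul y x)
  assoc : ∀ x y z, L.mul (L.mul x y) z = s (polar3 P (p x) (p y) (p z)) (L.mul x (L.mul y z))
  polar3_add : ∀ a b c d, polar3 P (a + b) c d = polar3 P a c d + polar3 P b c d

namespace IsExt

variable {L : LoopOn G} {p : G → V} {s : ZMod 2 → G → G} (h : L.IsExt p s)
include h

theorem map_one : p L.one = 0 := by
  have h1 := h.map_mul L.one L.one
  rw [L.one_mul] at h1
  simpa using h1

theorem smul_smul_self (a : ZMod 2) (x : G) : s a (s a x) = x := by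
  rw [h.smul_smul, ZMod.two_add_self, h.zero_smul]

theorem smul_injective (a : ZMod 2) : Function.Injective (s a) := fun x y hxy => by
  rw [← h.smul_smul_self a x, hxy, h.smul_smul_self]

theorem eq_smul_one {x : G} (hx : p x = 0) : ∃ a, x = s a L.one :=
  h.fiber _ _ (h.map_one.trans hx.symm)

theorem eq_smul_one_of_ne {x : G} (hx : p x = 0) (h1 : x ≠ L.one) : x = s 1 L.one := by
  obtain ⟨a, rfl⟩ := h.eq_smul_one hx
  fin_cases a
  · exact absurd (h.zero_smul _) h1
  · rfl

theorem smul_one_ne : s 1 L.one ≠ L.one := fun h1 =>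
  one_ne_zero (h.free 1 0 L.one (by rw [h1, h.zero_smul]))

theorem smul_one_mem_center (a : ZMod 2) : s a L.one ∈ L.center := by
  refine ⟨⟨Set.mem_univ _, fun x _ y _ => ⟨?_, ?_, ?_⟩⟩, fun x _ => ?_⟩ <;>
  simp only [h.smul_mul, h.mul_smul, L.one_mul, L.mul_one]

theorem toF_smul_one (a : ZMod 2) : L.toF (s a L.one) = a := by
  unfold toF
  split_ifs with h1
  · exact (h.free a 0 L.one (by rw [h1, h.zero_smul])).symm
  · have h2 : a ≠ 0 := fun h2 => h1 (by rw [h2, h.zero_smul])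
    exact (Fin.eq_one_of_ne_zero a h2).symm

theorem associator_eq {x y z : G} {a : ZMod 2}
    (hc : L.mul (L.mul x y) z = s a (L.mul x (L.mul y z))) :
    L.associator x y z = s a L.one := by
  refine ldiv_eq ?_
  rw [h.mul_smul, L.mul_one, hc]

theorem commutator_eq {x y : G} {a : ZMod 2} (hc : L.mul x y = s a (L.mul y x)) :
    L.commutator x y = s a L.one := by
  refine ldiv_eq ?_
  rw [h.mul_smul, L.mul_one, hc]

end IsExt

namespace IsCode

variable {L : LoopOn G} {p : G → V} {s : ZMod 2 → G → G} {P : V → ZMod 2} (h : L.IsCode p s P)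
include h

theorem power_zero : P 0 = 0 := by
  have h1 := h.sq L.one
  rw [L.one_mul, h.map_one] at h1
  exact h.free _ 0 L.one (by rw [← h1, h.zero_smul])

theorem polar3_self (a b : V) : polar3 P a a b = 0 := by
  obtain ⟨x, rfl⟩ := h.surj a
  have h2 : p x + p x = 0 := by rw [← h.map_mul, h.sq, h.map_smul, h.map_one]
  simp only [polar3, h2, zero_add, h.power_zero]
  linear_combination ZMod.two_add_self (P b) + ZMod.two_add_self (P (p x + b)) +
    ZMod.two_add_self (P (p x))

/-- Passing from ((xy)x)z to x(y(xz)) through (xy)(xz) costs two associators, which agree and cancel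
because the form is trilinear, symmetric and alternating. -/
theorem isMoufang : L.IsMoufang := by
  intro x y z
  have h1 := h.assoc (L.mul x y) x z
  have h2 := h.assoc x y (L.mul x z)
  have h3 : polar3 P (p x) (p y) (p (L.mul x z)) = polar3 P (p (L.mul x y)) (p x) (p z) := by
    rw [h.map_mul, h.map_mul, h.polar3_add, h.polar3_self, zero_add,
      ← polar3_rotate (p x) (p y) (p x + p z), ← polar3_rotate (p y) (p x + p z) (p x),
      h.polar3_add, h.polar3_self, zero_add, polar3_swap_left (p x) (p y),
      polar3_rotate (p z)]
  rw [h1, h2, h3, h.smul_smul_self]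

theorem associator_eq (x y z : G) :
    L.associator x y z = s (polar3 P (p x) (p y) (p z)) L.one :=
  h.toIsExt.associator_eq (h.assoc x y z)

end IsCode

end LoopOn

/-! ### Cosets, kernels and quotients -/

namespace NormalSubloop

open LoopOn

section Proj

variable {G : Type u} {L : LoopOn G} (S : NormalSubloop L)

theorem coset_mul_mem (x : G) {z : G} (hz : z ∈ S.carrier) : S.coset (L.mul x z) = S.coset x := by
  rw [coset, ← S.coset_left, coset]
  ext y
  constructor
  · rintro ⟨t, ht, rfl⟩
    exact ⟨_, S.mul_mem _ hz _ ht, rfl⟩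
  · rintro ⟨t, ht, rfl⟩
    exact ⟨_, S.ldiv_mem _ hz _ ht, congrArg (L.mul x) (L.mul_ldiv z t)⟩

theorem proj_eq_iff {x y : G} : S.proj x = S.proj y ↔ ∃ z ∈ S.carrier, y = L.mul x z := by
  rw [S.proj_eq]
  constructor
  · intro h
    have hy := S.mem_coset_self y
    rw [← h] at hy
    obtain ⟨z, hz, rfl⟩ := hy
    exact ⟨z, hz, rfl⟩
  · rintro ⟨z, hz, rfl⟩
    exact (S.coset_mul_mem x hz).symm

theorem proj_mul (x y : G) :
    S.proj (L.mul x y) = S.quotient.mul (S.proj x) (S.proj y) := rfl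

theorem proj_one : S.proj L.one = S.quotient.one := rfl

end Proj

section Ker

variable {G : Type u} (L : LoopOn G) {W : Type w} [AddCommGroup W] (f : G → W)
  (hf : ∀ x y, f (L.mul x y) = f x + f y)
include hf

theorem apply_one_of_map_mul : f L.one = 0 := by
  have h1 := hf L.one L.one
  rw [L.one_mul] at h1
  simpa using h1

theorem apply_ldiv (a b : G) : f (L.ldiv a b) = f b - f a := by
  rw [eq_sub_iff_add_eq', ← hf, L.mul_ldiv]

theorem apply_rdiv (a b : G) : f (L.rdiv b a) = f b - f a := by
  rw [eq_sub_iff_add_eq, ← hf, L.rdiv_mul]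

theorem image_left_ker (x : G) : (fun t => L.mul x t) '' {t | f t = 0} = {y | f y = f x} := by
  ext y
  constructor
  · rintro ⟨t, ht, rfl⟩
    have ht : f t = 0 := ht
    simp [hf, ht]
  · intro hy
    have hy : f y = f x := hy
    exact ⟨L.ldiv x y, by simp [apply_ldiv L f hf, hy], L.mul_ldiv x y⟩

theorem image_right_ker (x : G) : (fun t => L.mul t x) '' {t | f t = 0} = {y | f y = f x} := by
  ext y
  constructor
  · rintro ⟨t, ht, rfl⟩
    have ht : f t = 0 := ht
    simp [hf, ht]
  · intro hy
    have hy : f y = f x := hy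
    exact ⟨L.rdiv y x, by simp [apply_rdiv L f hf, hy], L.rdiv_mul y x⟩

/-- The kernel of a homomorphism to an abelian group. -/
def ker : NormalSubloop L where
  carrier := {t | f t = 0}
  one_mem := apply_one_of_map_mul L f hf
  mul_mem a ha b hb := by
    have ha : f a = 0 := ha
    have hb : f b = 0 := hb
    simp [hf, ha, hb]
  ldiv_mem a ha b hb := by
    have ha : f a = 0 := ha
    have hb : f b = 0 := hb
    simp [apply_ldiv L f hf, ha, hb]
  rdiv_mem a ha b hb := by
    have ha : f a = 0 := ha
    have hb : f b = 0 := hb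
    simp [apply_rdiv L f hf, ha, hb]
  coset_comm x := by rw [image_left_ker L f hf, image_right_ker L f hf]
  coset_left x y := by
    rw [image_left_ker L f hf, ← Set.image_image (fun t => L.mul x t) (fun t => L.mul y t),
      image_left_ker L f hf]
    ext z
    constructor
    · rintro ⟨t, ht, rfl⟩
      have ht : f t = f y := ht
      simp [hf, ht]
    · intro hz
      have hz : f z = f (L.mul x y) := hz
      exact ⟨L.ldiv x z, by simp [apply_ldiv L f hf, hz, hf], L.mul_ldiv x z⟩
  coset_right x y := by
    rw [image_right_ker L f hf, ← Set.image_image (fun t => L.mul t y) (fun t => L.mul t x),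
      image_right_ker L f hf]
    ext z
    constructor
    · rintro ⟨t, ht, rfl⟩
      have ht : f t = f x := ht
      simp [hf, ht]
    · intro hz
      have hz : f z = f (L.mul x y) := hz
      exact ⟨L.rdiv z y, by simp [apply_rdiv L f hf, hz, hf], L.rdiv_mul z y⟩

theorem proj_ker_eq_iff {x y : G} : (ker L f hf).proj x = (ker L f hf).proj y ↔ f x = f y := by
  rw [proj_eq]
  change (fun t => L.mul x t) '' {t | f t = 0} = (fun t => L.mul y t) '' {t | f t = 0} ↔ _
  rw [image_left_ker L f hf, image_left_ker L f hf]
  exact ⟨fun h => h.subset (show f x = f x from rfl), fun h => by rw [h]⟩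

/-- The first isomorphism theorem. -/
theorem exists_quotient_ker_equiv (hs : Function.Surjective f) :
    ∃ E : (ker L f hf).Quot ≃ W, (∀ x, E ((ker L f hf).proj x) = f x) ∧
      ∀ q r, E ((ker L f hf).quotient.mul q r) = E q + E r := by
  let g : (ker L f hf).Quot → W :=
    Quotient.lift f fun x y h => (proj_ker_eq_iff L f hf).1 (Quotient.sound h)
  have hg : ∀ x, g ((ker L f hf).proj x) = f x := fun x => rfl
  have hb : Function.Bijective g := by
    constructor
    · intro q r
      obtain ⟨x, rfl⟩ := exists_proj _ q
      obtain ⟨y, rfl⟩ := exists_proj _ r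
      intro h
      exact (proj_ker_eq_iff L f hf).2 h
    · intro a
      obtain ⟨x, rfl⟩ := hs a
      exact ⟨_, hg x⟩
  refine ⟨Equiv.ofBijective g hb, hg, fun q r => ?_⟩
  obtain ⟨x, rfl⟩ := exists_proj _ q
  obtain ⟨y, rfl⟩ := exists_proj _ r
  exact hf x y

end Ker

end NormalSubloop

/-! ### Translation between the two descriptions of a code loop -/

namespace LoopOn

variable {G : Type u} {L : LoopOn G}

theorem IsSymplecticWith.exists_isExt {Z : NormalSubloop L} {n : ℕ} {e : Z.Quot ≃ (Fin n → ZMod 2)}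
    (h : L.IsSymplecticWith Z n e) :
    ∃ s : ZMod 2 → G → G, L.IsExt (fun x => e (Z.proj x)) s ∧
      ∀ x ∈ Z.carrier, x = s (L.toF x) L.one := by
  obtain ⟨c, hc1, hc⟩ : ∃ c, c ≠ L.one ∧ Z.carrier = {L.one, c} := by
    have h2 : Z.carrier.ncard = 2 := h.card
    obtain ⟨a, b, hab, hZ⟩ := Set.ncard_eq_two.1 h2
    have h1 := Z.one_mem
    rw [hZ] at h1
    rcases h1 with h1 | h1
    · exact ⟨b, by rw [h1]; exact hab.symm, by rw [hZ, h1]⟩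
    · have h1 : L.one = b := h1
      exact ⟨a, by rw [h1]; exact hab, by rw [hZ, h1, Set.pair_comm]⟩
  have hcZ : c ∈ Z.carrier := by rw [hc]; simp
  obtain ⟨⟨-, hN⟩, hC⟩ := h.central hcZ
  have hcc : L.mul c c = L.one := by
    have h1 := Z.mul_mem c hcZ c hcZ
    rw [hc] at h1
    rcases h1 with h1 | h1
    · exact h1
    · exact absurd (mul_left_cancel (L := L) (a := c) (Eq.trans h1 (L.mul_one c).symm)) hc1
  have hne : ∀ x, L.mul c x ≠ x := fun x h1 =>
    hc1 (mul_right_cancel (L := L) (a := x) (by rw [h1, L.one_mul]))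
  have hN1 : ∀ x y, L.mul (L.mul c x) y = L.mul c (L.mul x y) := fun x y =>
    (hN x trivial y trivial).1
  have hN2 : ∀ x y, L.mul x (L.mul c y) = L.mul c (L.mul x y) := fun x y => by
    rw [← (hN x trivial y trivial).2.1, ← hC x trivial, hN1]
  have hF : ∀ P : ZMod 2 → Prop, P 0 → P 1 → ∀ a, P a := fun P h0 h1 a => by
    fin_cases a
    · exact h0
    · exact h1
  have h10 : (1 : ZMod 2) ≠ 0 := one_ne_zero
  refine ⟨fun a x => if a = 0 then x else L.mul c x, ⟨?_, ?_, ?_, ?_, ?_, ?_, ?_, ?_, ?_⟩, ?_⟩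
  · refine hF _ ?_ ?_ <;> intro x y <;> simp [hN1]
  · refine hF _ ?_ ?_ <;> intro x y <;> simp [hN2]
  · refine hF _ (hF _ ?_ ?_) (hF _ ?_ ?_) <;> intro x
    · simp
    · simp
    · simp
    · simp [ZMod.two_add_self, ← hN1, hcc, L.one_mul]
  · intro x; simp
  · refine hF _ (hF _ ?_ ?_) (hF _ ?_ ?_) <;> intro x
    · simp
    · simp only [if_true, if_neg h10]
      exact fun h1 => absurd h1.symm (hne x)
    · simp only [if_true, if_neg h10]
      exact fun h1 => absurd h1 (hne x)
    · simp
  · intro v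
    obtain ⟨x, hx⟩ := Z.exists_proj (e.symm v)
    exact ⟨x, by simp [hx]⟩
  · intro x y
    exact h.map_mul (Z.proj x) (Z.proj y)
  · refine hF _ ?_ ?_ <;> intro x
    · simp
    · simp only [if_neg h10, hC x trivial]
      exact congrArg e (Z.proj_eq_iff.2 ⟨c, hcZ, rfl⟩).symm
  · intro x y hxy
    obtain ⟨z, hz, rfl⟩ := Z.proj_eq_iff.1 (e.injective hxy)
    rw [hc] at hz
    rcases hz with rfl | hz
    · exact ⟨0, by simp [L.mul_one]⟩
    · have hz : z = c := hz
      exact ⟨1, by simp [hz, hC x trivial]⟩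
  · intro x hx
    rw [hc] at hx
    rcases hx with rfl | hx
    · simp [toF]
    · have hx : x = c := hx
      simp [toF, hx, hc1, L.mul_one]

/-- Squares, commutators and associators map to 0 in V, so they lie in Z and are determined by their
`toF` values. -/
theorem IsCodeWith.exists_isCode {Z : NormalSubloop L} {n : ℕ} {e : Z.Quot ≃ (Fin n → ZMod 2)}
    {P : (Fin n → ZMod 2) → ZMod 2} (h : L.IsCodeWith Z n e P) :
    ∃ s : ZMod 2 → G → G, L.IsCode (fun x => e (Z.proj x)) s P := by
  obtain ⟨s, hs, hF⟩ := h.symplectic.exists_isExt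
  have hp1 := hs.map_one
  have hZ : ∀ x, e (Z.proj x) = 0 → x ∈ Z.carrier := fun x hx => by
    obtain ⟨z, hz, rfl⟩ := Z.proj_eq_iff.1 (e.injective (hp1.trans hx.symm))
    rwa [L.one_mul]
  have h2 : ∀ v : Fin n → ZMod 2, v + v = 0 := fun v =>
    funext fun i => ZMod.two_add_self (v i)
  have hl : ∀ x y, L.mul x (L.ldiv x y) = y := L.mul_ldiv
  have hldiv : ∀ x y, e (Z.proj x) = e (Z.proj y) → e (Z.proj (L.ldiv x y)) = 0 := by
    intro x y hxy
    have h3 := hs.map_mul x (L.ldiv x y)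
    rw [hl, ← hxy] at h3
    simpa using h3.symm
  refine ⟨s, hs, fun x => ?_, fun x y => ?_, fun x y z => ?_, h.cdeg_le.polar3_add⟩
  · rw [h.power]
    exact hF _ (hZ _ ((hs.map_mul x x).trans (h2 _)))
  · have h3 := h.commutator_eq x y
    rw [derivedForm_two] at h3
    have h4 := hF (L.commutator x y) (hZ _ (hldiv _ _ (by
      rw [hs.map_mul, hs.map_mul, add_comm])))
    rw [h3] at h4
    have h5 : L.mul (L.mul y x) (L.commutator x y) = L.mul x y := hl _ _
    rw [← h5, h4, hs.mul_smul, L.mul_one]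
    rfl
  · have h3 := h.associator_eq x y z
    rw [derivedForm_three] at h3
    have h4 := hF (L.associator x y z) (hZ _ (hldiv _ _ (by
      simp only [hs.map_mul, add_assoc])))
    rw [h3] at h4
    have h5 : L.mul (L.mul x (L.mul y z)) (L.associator x y z) = L.mul (L.mul x y) z := hl _ _
    rw [← h5, h4, hs.mul_smul, L.mul_one]
    rfl

theorem IsCode.exists_isCodeWith {n : ℕ} {p : G → Fin n → ZMod 2} {s : ZMod 2 → G → G}
    {P : (Fin n → ZMod 2) → ZMod 2} (h : L.IsCode p s P) :
    ∃ (Z : NormalSubloop L) (e : Z.Quot ≃ (Fin n → ZMod 2)), L.IsCodeWith Z n e P := by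
  obtain ⟨E, hE, hmul⟩ := NormalSubloop.exists_quotient_ker_equiv L p h.map_mul h.surj
  refine ⟨NormalSubloop.ker L p h.map_mul, E, ⟨?_, ?_, hmul⟩, fun x => ?_,
    cdegLE_of_polar3_add h.polar3_add, fun x y => ?_, fun x y z => ?_⟩
  · intro x hx
    obtain ⟨a, rfl⟩ := h.eq_smul_one hx
    exact h.smul_one_mem_center a
  · have hc : (NormalSubloop.ker L p h.map_mul).carrier = {s 0 L.one, s 1 L.one} := by
      ext x
      constructor
      · intro hx
        obtain ⟨a, rfl⟩ := h.eq_smul_one hx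
        fin_cases a
        · left; rfl
        · right; rfl
      · rintro (hx | hx) <;> exact (congrArg p hx).trans ((h.map_smul _ _).trans h.map_one)
    have h01 : s 0 L.one ≠ s 1 L.one := fun h1 => zero_ne_one (h.free _ _ _ h1)
    have h2 := Set.ncard_pair h01
    rw [← hc] at h2
    exact h2
  · rw [hE, h.sq, h.toF_smul_one]
  · rw [h.toIsExt.commutator_eq (h.comm x y), h.toF_smul_one, derivedForm_two, hE, hE]
    rfl
  · rw [h.associator_eq, h.toF_smul_one, derivedForm_three, hE, hE, hE]
    rfl

theorem isCodeLoop_iff : L.IsCodeLoop ↔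
    ∃ (n : ℕ) (p : G → Fin n → ZMod 2) (s : ZMod 2 → G → G) (P : (Fin n → ZMod 2) → ZMod 2),
      L.IsCode p s P := by
  constructor
  · rintro ⟨Z, n, e, P, h⟩
    obtain ⟨s, hs⟩ := h.exists_isCode
    exact ⟨n, _, s, P, hs⟩
  · rintro ⟨n, p, s, P, h⟩
    obtain ⟨Z, e, he⟩ := h.exists_isCodeWith
    exact ⟨Z, n, e, P, he⟩

theorem radical3_eq_zero_iff {V : Type w} [AddCommGroup V] {P : V → ZMod 2} (h0 : P 0 = 0) :
    radical3 P = {0} ↔ ∀ a, (∀ b c, polar3 P a b c = 0) → a = 0 := by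
  constructor
  · intro h a ha
    exact h.subset (mem_radical3.2 ha)
  · intro h
    refine Set.Subset.antisymm (fun a ha => h a (mem_radical3.1 ha)) ?_
    rintro a rfl
    exact mem_radical3.2 (polar3_zero_left h0)

theorem isCodeLoopTrivialRadical_iff : L.IsCodeLoopTrivialRadical ↔
    ∃ (n : ℕ) (p : G → Fin n → ZMod 2) (s : ZMod 2 → G → G) (P : (Fin n → ZMod 2) → ZMod 2),
      L.IsCode p s P ∧ ∀ a, (∀ b c, polar3 P a b c = 0) → a = 0 := by
  constructor
  · rintro ⟨Z, n, e, P, h, hr⟩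
    obtain ⟨s, hs⟩ := h.exists_isCode
    exact ⟨n, _, s, P, hs, (radical3_eq_zero_iff hs.power_zero).1 hr⟩
  · rintro ⟨n, p, s, P, h, hr⟩
    obtain ⟨Z, e, he⟩ := h.exists_isCodeWith
    exact ⟨Z, n, e, P, he, (radical3_eq_zero_iff h.power_zero).2 hr⟩

end LoopOn

/-! ### Recognizing a code loop by its associator -/

theorem ZMod.two_eq_zero_or_one (a : ZMod 2) : a = 0 ∨ a = 1 := by
  revert a; decide

theorem ZMod.eq_of_eq_zero_iff {a b : ZMod 2} (h : a = 0 ↔ b = 0) : a = b := by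
  revert h; revert a b; decide

namespace LoopOn

/-- Equivalent associators: the associator of the second loop factors through the third derived
form of the first one. -/
theorem IsCode.exists_associator_eq {G : Type u} {H : Type v} {V : Type w} [AddCommGroup V]
    {L : LoopOn G} {K : LoopOn H} {p : G → V} {s : ZMod 2 → G → G} {P : V → ZMod 2}
    (h : L.IsCode p s P) (hLK : L.AssociatorEquiv K) :
    ∃ (φ : G ≃ H) (c : ZMod 2 → H), Function.Injective c ∧ c 0 = K.one ∧
      ∀ x y z, K.associator (φ x) (φ y) (φ z) = c (polar3 P (p x) (p y) (p z)) := by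
  obtain ⟨φ, ψ, hψ⟩ := hLK
  have hc : ∀ x y z, K.associator (φ x) (φ y) (φ z) =
      ψ (s (polar3 P (p x) (p y) (p z)) L.one) := fun x y z => by
    rw [← hψ, h.associator_eq]
  refine ⟨φ, fun a => ψ (s a L.one), fun a b hab => h.free _ _ _ (ψ.injective hab), ?_, hc⟩
  -- As φ need not preserve the neutral element, the third argument is chosen as the preimage of
  -- `K.one`; the first makes the form vanish.
  have h1 := hc L.one L.one (φ.symm K.one)
  rw [h.map_one, polar3_zero_left h.power_zero] at h1
  refine h1.symm.trans (ldiv_eq ?_)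
  simp [K.mul_one]

section Recognition

variable {H : Type v} {V : Type w} [AddCommGroup V] {K : LoopOn H} {q : H → V}
  {s : ZMod 2 → H → H} {B : V → V → V → ZMod 2}

/-- A Moufang loop whose associator map is a symmetric trilinear form on the classes of a free
central action of `ZMod 2` has exponent two modulo this action, and the classes commute. -/
theorem IsMoufang.map_mul_of_associator (hK : K.IsMoufang)
    (smul_mul : ∀ a x y, K.mul (s a x) y = s a (K.mul x y))
    (mul_smul : ∀ a x y, K.mul x (s a y) = s a (K.mul x y))
    (smul_smul : ∀ a b x, s a (s b x) = s (a + b) x)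
    (zero_smul : ∀ x, s 0 x = x)
    (free : ∀ a b x, s a x = s b x → a = b)
    (surj : Function.Surjective q)
    (map_smul : ∀ a x, q (s a x) = q x)
    (fiber : ∀ x y, q x = q y → ∃ a, y = s a x)
    (assoc : ∀ x y z, K.mul (K.mul x y) z = s (B (q x) (q y) (q z)) (K.mul x (K.mul y z)))
    (add : ∀ a b c d, B (a + b) c d = B a c d + B b c d)
    (swap_left : ∀ a b c, B b a c = B a b c)
    (swap_right : ∀ a b c, B a c b = B a b c)
    (nondeg : ∀ a b, (∀ c d, B a c d = B b c d) → a = b) :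
    (∀ x, q (K.mul x x) = 0) ∧ ∀ x y, q (K.mul x y) = q x + q y := by
  have hzero : ∀ v w, B 0 v w = 0 := fun v w => by
    have h := add 0 0 v w
    rw [add_zero] at h
    simpa using h
  have hq1 : q K.one = 0 := by
    refine nondeg _ _ fun v w => ?_
    obtain ⟨y, rfl⟩ := surj v
    obtain ⟨z, rfl⟩ := surj w
    have h := assoc K.one y z
    rw [K.one_mul, K.one_mul] at h
    rw [hzero]
    exact free _ _ (K.mul y z) (by rw [← h, zero_smul])
  -- Expand ((xy)z)x in two ways and compare by the middle Moufang identity.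
  have hmid : ∀ x y z, B (q (K.mul x y)) (q z) (q x) = B (q x) (q y) (q z) := fun x y z => by
    have h1 := assoc (K.mul x y) z x
    rw [assoc x y z, smul_mul, hK.middle_moufang] at h1
    exact (free _ _ _ h1).symm
  have halt : ∀ x z, B (q x) (q x) (q z) = 0 := fun x z => by
    have h := hmid x K.one z
    rw [K.mul_one, hq1, swap_right, swap_left (0 : V), hzero] at h
    exact h
  -- The pentagon: the two ways of reassociating ((wx)y)z into w(x(yz)).
  have hpent : ∀ w x y z, B (q (K.mul w x)) (q y) (q z) + B (q w) (q x) (q (K.mul y z)) =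
      B (q w) (q x) (q y) + B (q w) (q (K.mul x y)) (q z) + B (q x) (q y) (q z) := by
    intro w x y z
    have h1 : K.mul (K.mul (K.mul w x) y) z = _ := assoc (K.mul w x) y z
    rw [assoc w x (K.mul y z), assoc w x y, smul_mul, assoc w (K.mul x y) z, assoc x y z, mul_smul,
      smul_smul, smul_smul, smul_smul] at h1
    rw [← free _ _ _ h1]
  have hsq : ∀ x, q (K.mul x x) = 0 := fun x => by
    refine nondeg _ _ fun v w => ?_
    obtain ⟨y, rfl⟩ := surj v
    obtain ⟨z, rfl⟩ := surj w
    have h := hpent x x y z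
    rw [halt, halt, swap_left (q (K.mul x y)), swap_right (q (K.mul x y)), hmid] at h
    rw [hzero]
    linear_combination h + ZMod.two_add_self (B (q x) (q y) (q z))
  -- Both (xy)(yx) = (x(yy))x and (xy)(xy) lie in the fibre of 1, so cancelling xy puts xy and yx in
  -- one fibre.
  have hcomm : ∀ x y, q (K.mul x y) = q (K.mul y x) := fun x y => by
    obtain ⟨a, ha⟩ := fiber _ _ (hq1.trans (hsq y).symm)
    have h1 : q (K.mul (K.mul x y) (K.mul y x)) = 0 := by
      rw [hK.middle_moufang, ha, mul_smul, K.mul_one, smul_mul, map_smul, hsq]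
    obtain ⟨b, hb⟩ := fiber _ _ ((hsq (K.mul x y)).trans h1.symm)
    rw [← mul_smul] at hb
    rw [mul_left_cancel hb, map_smul]
  refine ⟨hsq, fun w x => nondeg _ _ fun v u => ?_⟩
  obtain ⟨y, rfl⟩ := surj v
  obtain ⟨z, rfl⟩ := surj u
  -- D is the additivity defect of q as seen by B. It is symmetric in its first and in its last
  -- pair, and the pentagon becomes a three-term relation.
  obtain ⟨D, hD⟩ : ∃ D : H → H → H → H → ZMod 2, ∀ w x y z, D w x y z =
      B (q (K.mul w x)) (q y) (q z) + B (q w) (q y) (q z) + B (q x) (q y) (q z) :=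
    ⟨_, fun _ _ _ _ => rfl⟩
  have hD1 : ∀ w x y z, D x w y z = D w x y z := fun w x y z => by
    rw [hD, hD, hcomm x w]; ring
  have hD2 : ∀ w x y z, D w x z y = D w x y z := fun w x y z => by
    rw [hD, hD, swap_right, swap_right (q w), swap_right (q x)]
  have hR : ∀ w x y z, D w x y z + D y z w x = D x y w z := fun w x y z => by
    have h := hpent w x y z
    rw [hD, hD, hD, swap_left (q w) (q (K.mul y z)), swap_right (q w) (q x) (q (K.mul y z)),
      swap_left (q w) (q (K.mul x y)), swap_left (q w) (q y) (q x),
      swap_right (q w) (q x) (q y), swap_left (q w) (q z), swap_right (q w) (q x) (q z),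
      swap_left (q w) (q x) (q z), swap_left (q w) (q y) (q z)]
    linear_combination h + ZMod.two_add_self (B (q w) (q x) (q y)) +
      ZMod.two_add_self (B (q x) (q y) (q z))
  -- By the second and third instances the two summands in the first one are equal, so their sum
  -- vanishes.
  have hD0 : D w x y z = 0 := by
    have h1 := hR y w x z
    have h2 := hR x y w z
    have h3 := hR y x z w
    rw [hD1 x y, hD2 x y, hD1 w z, hD2 w z, h2] at h3
    rw [h3, ZMod.two_add_self] at h1
    exact h1.symm
  rw [add]
  rw [hD] at hD0
  linear_combination hD0 - ZMod.two_add_self (B (q w) (q y) (q z)) -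
    ZMod.two_add_self (B (q x) (q y) (q z))

/-- A Moufang loop over `V` whose associator map is an additive symmetric form is a code loop. -/
theorem IsExt.exists_isCode (h : K.IsExt q s) (hK : K.IsMoufang)
    (hsq : ∀ x, q (K.mul x x) = 0)
    (assoc : ∀ x y z, K.mul (K.mul x y) z = s (B (q x) (q y) (q z)) (K.mul x (K.mul y z)))
    (add : ∀ a b c d, B (a + b) c d = B a c d + B b c d)
    (swap_left : ∀ a b c, B b a c = B a b c)
    (swap_right : ∀ a b c, B a c b = B a b c) :
    ∃ P : V → ZMod 2, K.IsCode q s P ∧ polar3 P = B := by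
  choose f hf using fun x => h.eq_smul_one (hsq x)
  obtain ⟨P, hP⟩ : ∃ P : V → ZMod 2, ∀ x, K.mul x x = s (P (q x)) K.one := by
    refine ⟨fun v => f (Function.surjInv h.surj v), fun x => ?_⟩
    obtain ⟨a, ha⟩ := h.fiber (Function.surjInv h.surj (q x)) x (Function.surjInv_eq h.surj _)
    conv_lhs => rw [ha]
    rw [h.smul_mul, h.mul_smul, h.smul_smul_self, hf]
  -- If xy is yx moved by t, then (xy)² is (xy)(yx) = (x(yy))x moved by t, whence P(x + y) = t +
  -- P(x) + P(y).
  have hcomm : ∀ x y, K.mul x y = s (polar P (q x) (q y)) (K.mul y x) := by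
    intro x y
    obtain ⟨t, ht⟩ := h.fiber (K.mul y x) (K.mul x y) (by rw [h.map_mul, h.map_mul, add_comm])
    have h1 := hP (K.mul x y)
    have h2 := hK.middle_moufang x y y
    rw [hP y, h.mul_smul, K.mul_one, h.smul_mul, hP x, h.smul_smul] at h2
    have h3 : K.mul (K.mul x y) (K.mul x y) = s t (K.mul (K.mul x y) (K.mul y x)) := by
      rw [← h.mul_smul, ← ht]
    rw [h3, h2, h.smul_smul, h.map_mul] at h1
    rw [ht, polar, ← h.free _ _ _ h1]
    congr 1
    linear_combination -ZMod.two_add_self (P (q x)) - ZMod.two_add_self (P (q y))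
  -- Moving z past xy at once or one factor at a time differs by three associators, all equal to B;
  -- their sum is B.
  have hB : ∀ x y z, polar3 P (q x) (q y) (q z) = B (q x) (q y) (q z) := by
    intro x y z
    have h1 := hcomm (K.mul x y) z
    have h2 : K.mul x (K.mul z y) = s (B (q x) (q y) (q z)) (K.mul (K.mul x z) y) := by
      rw [assoc x z y, swap_right, h.smul_smul_self]
    rw [assoc x y z, hcomm y z, h.mul_smul, h2, hcomm x z, h.smul_mul, assoc z x y,
      swap_left (q x) (q z) (q y), swap_right (q x) (q y) (q z), h.smul_smul, h.smul_smul,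
      h.smul_smul, h.smul_smul, h.map_mul] at h1
    rw [polar3_eq, ← h.free _ _ _ h1]
    linear_combination ZMod.two_add_self (B (q x) (q y) (q z)) +
      ZMod.two_add_self (polar P (q y) (q z)) + ZMod.two_add_self (polar P (q x) (q z))
  have hPB : polar3 P = B := by
    funext a b c
    obtain ⟨x, rfl⟩ := h.surj a
    obtain ⟨y, rfl⟩ := h.surj b
    obtain ⟨z, rfl⟩ := h.surj c
    exact hB x y z
  exact ⟨P, ⟨h, hP, hcomm, fun x y z => by rw [hPB]; exact assoc x y z,
    by rw [hPB]; exact add⟩, hPB⟩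

/-- A Moufang loop whose associator map is a nondegenerate trilinear form on the classes of a
partition into pairs is a code loop. -/
theorem IsMoufang.exists_isCode_of_associator (hK : K.IsMoufang) {c : ZMod 2 → H}
    (hc : Function.Injective c) (hc0 : c 0 = K.one)
    (surj : Function.Surjective q)
    (pair : ∀ x, ∃ x', x' ≠ x ∧ ∀ y, q y = q x ↔ y = x ∨ y = x')
    (assoc : ∀ x y z, K.associator x y z = c (B (q x) (q y) (q z)))
    (add : ∀ a b c d, B (a + b) c d = B a c d + B b c d)
    (swap_left : ∀ a b c, B b a c = B a b c)
    (swap_right : ∀ a b c, B a c b = B a b c)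
    (nondeg : ∀ a, (∀ b c, B a b c = 0) → a = 0) :
    ∃ (s : ZMod 2 → H → H) (P : V → ZMod 2), K.IsCode q s P ∧ polar3 P = B := by
  have hzero : ∀ v w, B 0 v w = 0 := fun v w => by
    have h := add 0 0 v w
    rw [add_zero] at h
    simpa using h
  have hnd : ∀ a b, (∀ v w, B a v w = B b v w) → a = b := fun a b h => by
    refine sub_eq_zero.1 (nondeg _ fun v w => ?_)
    have h1 := add (a - b) b v w
    rw [sub_add_cancel, h v w] at h1
    simpa using h1
  have hiff : ∀ x y z, B (q x) (q y) (q z) = 0 ↔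
      K.mul (K.mul x y) z = K.mul x (K.mul y z) := fun x y z => by
    have h1 := mul_associator (L := K) x y z
    rw [assoc] at h1
    constructor
    · intro h
      rw [h, hc0, K.mul_one] at h1
      exact h1.symm
    · intro h
      rw [h] at h1
      exact hc ((mul_left_cancel (h1.trans (K.mul_one _).symm)).trans hc0.symm)
  have hqzero : ∀ x, (∀ y z, K.mul (K.mul x y) z = K.mul x (K.mul y z)) → q x = 0 := by
    intro x hx
    refine nondeg _ fun v w => ?_
    obtain ⟨y, rfl⟩ := surj v
    obtain ⟨z, rfl⟩ := surj w
    exact (hiff x y z).2 (hx y z)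
  have hq1 : q K.one = 0 := hqzero _ fun y z => by rw [K.one_mul, K.one_mul]
  obtain ⟨ν, hν1, hν⟩ := pair K.one
  rw [hq1] at hν
  have hqν : q ν = 0 := (hν ν).2 (Or.inr rfl)
  have hN1 : ∀ x y, K.mul (K.mul ν x) y = K.mul ν (K.mul x y) := fun x y =>
    (hiff _ _ _).1 (by rw [hqν, hzero])
  have hN2 : ∀ x y, K.mul (K.mul x ν) y = K.mul x (K.mul ν y) := fun x y =>
    (hiff _ _ _).1 (by rw [hqν, swap_left, hzero])
  have hne : ∀ x, K.mul ν x ≠ x := fun x h =>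
    hν1 (mul_right_cancel (h.trans (K.one_mul x).symm))
  have hne' : ∀ x, K.mul x ν ≠ x := fun x h =>
    hν1 (mul_left_cancel (h.trans (K.mul_one x).symm))
  have hνν : K.mul ν ν = K.one := by
    rcases (hν (K.mul ν ν)).1 (hqzero _ fun y z => by rw [hN1, hN1, hN1, hN1]) with h | h
    · exact h
    · exact absurd h (hne ν)
  -- The triples (νx, y, z) and (x, y, z) associate simultaneously, and a form with values in F is
  -- determined by its zeros.
  have hqmul : ∀ x, q (K.mul ν x) = q x := fun x => by
    refine hnd _ _ fun v w => ?_
    obtain ⟨y, rfl⟩ := surj v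
    obtain ⟨z, rfl⟩ := surj w
    have h1 := hiff (K.mul ν x) y z
    rw [hN1, hN1, hN1, (K.bijective_left ν).1.eq_iff, ← hiff] at h1
    exact ZMod.eq_of_eq_zero_iff h1
  have hqmul' : ∀ x, q (K.mul x ν) = q x := fun x => by
    refine hnd _ _ fun v w => ?_
    obtain ⟨y, rfl⟩ := surj v
    obtain ⟨z, rfl⟩ := surj w
    have h1 := hiff (K.mul x ν) y z
    rw [hN2, hN2, ← hN1, ← hiff x, hqmul] at h1
    exact ZMod.eq_of_eq_zero_iff h1
  have hfib : ∀ x y, q y = q x ↔ y = x ∨ y = K.mul ν x := fun x y => by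
    obtain ⟨x', hx', h⟩ := pair x
    rcases (h _).1 (hqmul x) with h1 | h1
    · exact absurd h1 (hne x)
    · rw [h1, h]
  have hcomm : ∀ x, K.mul x ν = K.mul ν x := fun x =>
    ((hfib x _).1 (hqmul' x)).resolve_left (hne' x)
  have hcν : c 1 = ν := by
    obtain ⟨a, ha⟩ := (K.bijective_right (c 1)).2 K.one
    have ha : K.mul a (c 1) = K.one := ha
    have hqa : q a = 0 := by
      refine nondeg _ fun v w => ?_
      obtain ⟨y, rfl⟩ := surj v
      obtain ⟨z, rfl⟩ := surj w
      rcases ZMod.two_eq_zero_or_one (B (q a) (q y) (q z)) with h | h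
      · exact h
      · exfalso
        -- With this x, a[x, y, z] = x. A trivial associator gives x = a, against B(a, y, z) = 1;
        -- the value c(1) gives x = 1, whose form vanishes.
        let x := K.ldiv z (K.ldiv y (K.mul (K.mul y z) a))
        have hx : K.mul y (K.mul z x) = K.mul (K.mul y z) a := by
          rw [K.mul_ldiv, K.mul_ldiv]
        have h2 := hK.mul_associator_of_eq hx
        rw [assoc] at h2
        rcases ZMod.two_eq_zero_or_one (B (q x) (q y) (q z)) with h3 | h3
        · rw [h3, hc0, K.mul_one] at h2
          rw [← h2, h] at h3
          exact one_ne_zero h3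
        · rw [h3, ha] at h2
          rw [← h2, hq1, hzero] at h3
          exact zero_ne_one h3
    rcases (hν a).1 hqa with h | h
    · rw [h, K.one_mul] at ha
      exact absurd (hc (ha.trans hc0.symm)) one_ne_zero
    · rw [h] at ha
      exact mul_left_cancel (ha.trans hνν.symm)
  have hF : ∀ Q : ZMod 2 → Prop, Q 0 → Q 1 → ∀ a, Q a := fun Q h0 h1 a => by
    rcases ZMod.two_eq_zero_or_one a with rfl | rfl
    · exact h0
    · exact h1
  have h10 : (1 : ZMod 2) ≠ 0 := one_ne_zero
  obtain ⟨s, hs0, hs1⟩ : ∃ s : ZMod 2 → H → H, (∀ x, s 0 x = x) ∧ ∀ x, s 1 x = K.mul ν x :=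
    ⟨fun a x => if a = 0 then x else K.mul ν x, fun x => by simp, fun x => by simp⟩
  have smul_mul : ∀ a x y, K.mul (s a x) y = s a (K.mul x y) := by
    refine hF _ ?_ ?_ <;> intro x y
    · simp only [hs0]
    · simp only [hs1, hN1]
  have mul_smul : ∀ a x y, K.mul x (s a y) = s a (K.mul x y) := by
    refine hF _ ?_ ?_ <;> intro x y
    · simp only [hs0]
    · simp only [hs1, ← hN2, hcomm, hN1]
  have smul_smul : ∀ a b x, s a (s b x) = s (a + b) x := by
    refine hF _ (hF _ ?_ ?_) (hF _ ?_ ?_) <;> intro x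
    · rw [add_zero, hs0]
    · rw [zero_add, hs0]
    · rw [add_zero, hs0]
    · rw [ZMod.two_add_self, hs0, hs1, hs1, ← hN1, hνν, K.one_mul]
  have free : ∀ a b x, s a x = s b x → a = b := by
    refine hF _ (hF _ ?_ ?_) (hF _ ?_ ?_) <;> intro x h
    · rfl
    · rw [hs0, hs1] at h
      exact absurd h.symm (hne x)
    · rw [hs0, hs1] at h
      exact absurd h (hne x)
    · rfl
  have map_smul : ∀ a x, q (s a x) = q x := by
    refine hF _ ?_ ?_ <;> intro x
    · rw [hs0]
    · rw [hs1, hqmul]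
  have fiber : ∀ x y, q x = q y → ∃ a, y = s a x := fun x y h => by
    rcases (hfib x y).1 h.symm with h | h
    · exact ⟨0, by rw [hs0, h]⟩
    · exact ⟨1, by rw [hs1, h]⟩
  have hcs : ∀ a, c a = s a K.one := by
    refine hF _ ?_ ?_
    · rw [hs0, hc0]
    · rw [hs1, K.mul_one, hcν]
  have hassoc : ∀ x y z, K.mul (K.mul x y) z = s (B (q x) (q y) (q z)) (K.mul x (K.mul y z)) :=
    fun x y z => by
    rw [← mul_associator, assoc, hcs, mul_smul, K.mul_one]
  obtain ⟨hsq, hmul⟩ := hK.map_mul_of_associator smul_mul mul_smul smul_smul hs0 free surj map_smul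
    fiber hassoc add swap_left swap_right hnd
  obtain ⟨P, hP⟩ := IsExt.exists_isCode
    ⟨smul_mul, mul_smul, smul_smul, hs0, free, surj, hmul, map_smul, fiber⟩ hK hsq hassoc add
    swap_left swap_right
  exact ⟨s, P, hP⟩

end Recognition

theorem IsCodeLoopTrivialRadical.of_associatorEquiv {G : Type u} {H : Type v} {L : LoopOn G}
    {K : LoopOn H} (hL : L.IsCodeLoopTrivialRadical) (hK : K.IsMoufang)
    (hLK : L.AssociatorEquiv K) : K.IsCodeLoopTrivialRadical := by
  obtain ⟨n, p, s, P, h, hr⟩ := isCodeLoopTrivialRadical_iff.1 hL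
  obtain ⟨φ, c, hc, hc0, hassoc⟩ := h.exists_associator_eq hLK
  obtain ⟨s', P', h', hP'⟩ := hK.exists_isCode_of_associator (q := fun x => p (φ.symm x))
    (B := polar3 P) hc hc0 (h.surj.comp φ.symm.surjective) (fun x => by
      refine ⟨φ (s 1 (φ.symm x)), fun h1 => ?_, fun y => ⟨fun h1 => ?_, ?_⟩⟩
      · have h2 : s 1 (φ.symm x) = s 0 (φ.symm x) := by
          rw [h.zero_smul]
          exact φ.injective (h1.trans (φ.apply_symm_apply x).symm)
        exact one_ne_zero (h.free _ _ _ h2)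
      · obtain ⟨a, ha⟩ := h.fiber _ _ h1.symm
        rcases ZMod.two_eq_zero_or_one a with rfl | rfl
        · left
          rw [h.zero_smul] at ha
          exact φ.symm.injective ha
        · right
          rw [← ha, φ.apply_symm_apply]
      · rintro (rfl | rfl)
        · rfl
        · simp only [φ.symm_apply_apply, h.map_smul])
    (fun x y z => by simpa using hassoc (φ.symm x) (φ.symm y) (φ.symm z)) h.polar3_add
    polar3_swap_left polar3_swap_right hr
  exact isCodeLoopTrivialRadical_iff.2 ⟨n, _, s', P', h', by rw [hP']; exact hr⟩

end LoopOn

/-! ### Biadditive twists and the constructions with m = 1 -/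

namespace LoopOn

variable {G : Type u} {L : LoopOn G} {V : Type w} [AddCommGroup V] {p : G → V}
  {s : ZMod 2 → G → G}

/-- A map that is additive in both arguments and invariant under the action of `ZMod 2`. -/
structure IsBiadd (L : LoopOn G) (s : ZMod 2 → G → G) (f : G → G → ZMod 2) : Prop where
  add_left : ∀ x y z, f (L.mul x y) z = f x z + f y z
  add_right : ∀ x y z, f x (L.mul y z) = f x y + f x z
  smul_left : ∀ a x y, f (s a x) y = f x y
  smul_right : ∀ a x y, f x (s a y) = f x y

/-- The multiplication of `K` is `x * y = (xy) h ^ f(x, y)`, where `h = s 1 1`. -/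
structure IsTwist (L : LoopOn G) (s : ZMod 2 → G → G) (f : G → G → ZMod 2) (K : LoopOn G) :
    Prop where
  one : K.one = L.one
  mul : ∀ x y, K.mul x y = s (f x y) (L.mul x y)

theorem IsExt.exists_isTwist (h : L.IsExt p s) {f : G → G → ZMod 2} (hf : L.IsBiadd s f) :
    ∃ K, L.IsTwist s f K := by
  have h1 : ∀ x, f L.one x = 0 := fun x => by
    have h2 := hf.add_left L.one L.one x
    rw [L.one_mul] at h2
    simpa using h2
  have h2 : ∀ x, f x L.one = 0 := fun x => by
    have h2 := hf.add_right x L.one L.one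
    rw [L.one_mul] at h2
    simpa using h2
  refine ⟨⟨fun x y => s (f x y) (L.mul x y), L.one, fun x => ?_, fun x => ?_,
    fun a => ⟨fun x y hxy => ?_, fun b => ?_⟩, fun a => ⟨fun x y hxy => ?_, fun b => ?_⟩⟩, rfl,
    fun _ _ => rfl⟩
  · rw [h1, h.zero_smul, L.one_mul]
  · rw [h2, h.zero_smul, L.mul_one]
  · simp only [← h.mul_smul] at hxy
    have h3 := mul_left_cancel hxy
    have h4 := congrArg (f a) h3
    rw [hf.smul_right, hf.smul_right] at h4
    rw [h4] at h3
    exact h.smul_injective _ h3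
  · refine ⟨s (f a (L.ldiv a b)) (L.ldiv a b), ?_⟩
    simp only [hf.smul_right, h.mul_smul, h.smul_smul_self, L.mul_ldiv]
  · simp only [← h.smul_mul] at hxy
    have h3 := mul_right_cancel hxy
    have h4 := congrArg (fun t => f t a) h3
    simp only [hf.smul_left] at h4
    rw [h4] at h3
    exact h.smul_injective _ h3
  · refine ⟨s (f (L.rdiv b a) a) (L.rdiv b a), ?_⟩
    simp only [hf.smul_left, h.smul_mul, h.smul_smul_self, L.rdiv_mul]

namespace IsTwist

variable {f : G → G → ZMod 2} {K : LoopOn G} (hK : L.IsTwist s f K) (h : L.IsExt p s)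
  (hf : L.IsBiadd s f)
include hK h hf

theorem isExt : K.IsExt p s where
  smul_mul a x y := by
    rw [hK.mul, hK.mul, hf.smul_left, h.smul_mul, h.smul_smul, h.smul_smul, add_comm]
  mul_smul a x y := by
    rw [hK.mul, hK.mul, hf.smul_right, h.mul_smul, h.smul_smul, h.smul_smul, add_comm]
  smul_smul := h.smul_smul
  zero_smul := h.zero_smul
  free := h.free
  surj := h.surj
  map_mul x y := by rw [hK.mul, h.map_smul, h.map_mul]
  map_smul := h.map_smul
  fiber := h.fiber

theorem mul_mul_left (x y z : G) :
    K.mul (K.mul x y) z = s (f x y + f x z + f y z) (L.mul (L.mul x y) z) := by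
  rw [hK.mul, hK.mul, hf.smul_left, hf.add_left, h.smul_mul, h.smul_smul]
  congr 1
  ring

theorem mul_mul_right (x y z : G) :
    K.mul x (K.mul y z) = s (f x y + f x z + f y z) (L.mul x (L.mul y z)) := by
  rw [hK.mul, hK.mul, hf.smul_right, hf.add_right, h.mul_smul, h.smul_smul]

/-- Each bracketing of a word contributes f once for every pair of letters taken in order, and both
sides of the identity bracket the word x, y, x, z. -/
theorem isMoufang (hL : L.IsMoufang) : K.IsMoufang := by
  intro x y z
  rw [hK.mul_mul_left h hf, hK.mul x z, hK.mul_mul_right h hf, hK.mul x y, h.smul_mul,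
    h.smul_mul, h.mul_smul, h.mul_smul, hL x y z, h.smul_smul, h.smul_smul]
  simp only [hf.smul_left, hf.smul_right, hf.add_left, hf.add_right]
  congr 1
  ring

theorem mul_mul_left_eq {x y z : G} {a : ZMod 2}
    (ha : L.mul (L.mul x y) z = s a (L.mul x (L.mul y z))) :
    K.mul (K.mul x y) z = s a (K.mul x (K.mul y z)) := by
  rw [hK.mul_mul_left h hf, hK.mul_mul_right h hf, ha, h.smul_smul, h.smul_smul, add_comm]

end IsTwist

theorem IsCode.exists_isTwist_trivialRadical {n : ℕ} {p : G → Fin n → ZMod 2}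
    {P : (Fin n → ZMod 2) → ZMod 2} (h : L.IsCode p s P)
    (hr : ∀ a, (∀ b c, polar3 P a b c = 0) → a = 0) {f : G → G → ZMod 2} (hf : L.IsBiadd s f) :
    ∃ K, L.IsTwist s f K ∧ K.IsCodeLoopTrivialRadical ∧ L.AssociatorEquiv K ∧
      ∀ x y z, K.associator x y z = L.associator x y z := by
  obtain ⟨K, hK⟩ := h.exists_isTwist hf
  have hass : ∀ x y z, K.associator x y z = L.associator x y z := fun x y z => by
    rw [h.associator_eq, (hK.isExt h.toIsExt hf).associator_eq
      (hK.mul_mul_left_eq h.toIsExt hf (h.assoc x y z)), hK.one]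
  have heq : L.AssociatorEquiv K :=
    ⟨Equiv.refl G, Equiv.refl G, fun x y z => (hass x y z).symm⟩
  exact ⟨K, hK, (isCodeLoopTrivialRadical_iff.2 ⟨n, p, s, P, h, hr⟩).of_associatorEquiv
    (hK.isMoufang h.toIsExt hf h.isMoufang) heq, heq, hass⟩

/-- The twist of a code loop by a product of two functionals. -/
theorem IsCode.twist {P : V → ZMod 2} (h : L.IsCode p s P) {a b : V → ZMod 2}
    (ha : ∀ v w, a (v + w) = a v + a w) (hb : ∀ v w, b (v + w) = b v + b w) {K : LoopOn G}
    (hK : L.IsTwist s (fun x y => a (p x) * b (p y)) K) :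
    K.IsCode p s (fun v => P v + a v * b v) := by
  have hf : L.IsBiadd s (fun x y => a (p x) * b (p y)) :=
    ⟨fun x y z => by simp only [h.map_mul, ha, add_mul],
      fun x y z => by simp only [h.map_mul, hb, mul_add],
      fun c x y => by simp only [h.map_smul], fun c x y => by simp only [h.map_smul]⟩
  -- A product of two functionals is quadratic, so its third derived form is zero.
  have h3 : polar3 (fun v => P v + a v * b v) = polar3 P := by
    funext x y z
    simp only [polar3, ha, hb]
    linear_combination ZMod.two_add_self (a x * b x + a y * b y + a z * b z) * 2 +
      ZMod.two_add_self (a x * b y + a y * b x + a x * b z + a z * b x + a y * b z + a z * b y)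
  refine ⟨hK.isExt h.toIsExt hf, fun x => ?_, fun x y => ?_, fun x y z => ?_, ?_⟩
  · rw [hK.mul, h.sq, hK.one, h.smul_smul, add_comm]
  · rw [hK.mul, hK.mul, h.comm, h.smul_smul, h.smul_smul]
    congr 1
    simp only [polar, ha, hb]
    linear_combination -ZMod.two_add_self (a (p x) * b (p x)) -
      ZMod.two_add_self (a (p y) * b (p y)) - ZMod.two_add_self (a (p y) * b (p x))
  · rw [h3]
    exact hK.mul_mul_left_eq h.toIsExt hf (h.assoc x y z)
  · rw [h3]
    exact h.polar3_add

theorem mem_exponentSet_one {i : ℤ} : i ∈ exponentSet 1 ↔ i = 0 ∨ i = 1 := by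
  simp only [exponentSet, Set.mem_Icc, Nat.cast_one]
  omega

theorem zpow_zero (x : G) : L.zpow x 0 = L.one := rfl

theorem zpow_one (x : G) : L.zpow x 1 = x := L.one_mul x

/-- For i, j in {0, 1}, σ(i + j) is nonzero only at i = j = 1, so it equals ij; the sign is
irrelevant because the element has order two. -/
theorem IsExt.zpow_sigma (h : L.IsExt p s) {i j : ℤ} (hi : i ∈ exponentSet 1)
    (hj : j ∈ exponentSet 1) : L.zpow (s 1 L.one) (sigma 1 (i + j)) = s (i * j : ZMod 2) L.one ∧
      L.zpow (s 1 L.one) (-sigma 1 (i + j)) = s (i * j : ZMod 2) L.one := by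
  have h0 : L.zpow (s 1 L.one) (-0) = L.one := rfl
  have h1 : L.zpow (s 1 L.one) (-1) = s 1 L.one := by
    change L.inv (L.npow (s 1 L.one) 1) = _
    refine ldiv_eq ?_
    change L.mul (L.mul L.one _) _ = _
    rw [L.one_mul, h.smul_mul, L.one_mul, h.smul_smul_self]
  rw [mem_exponentSet_one] at hi hj
  rcases hi with rfl | rfl <;> rcases hj with rfl | rfl <;>
    simp [sigma, h.zero_smul, zpow_zero, zpow_one, h1]

theorem IsExt.isCyclicResult (h : L.IsExt p s) {S : NormalSubloop L} {α : S.Quot}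
    {t : S.Quot → ZMod 2} (t1 : t S.quotient.one = 0) (tα : t α = 1) {K : LoopOn G}
    (hK : L.IsTwist s (fun x y => t (S.proj x) * t (S.proj y)) K) :
    L.IsCyclicResult S 1 α (s 1 L.one) K := by
  have ht : ∀ i ∈ exponentSet 1, t (S.quotient.zpow α i) = (i : ZMod 2) := by
    intro i hi
    rcases mem_exponentSet_one.1 hi with rfl | rfl
    · rw [zpow_zero, t1, Int.cast_zero]
    · rw [zpow_one, tα, Int.cast_one]
  intro i hi j hj x y hx hy
  rw [hK.mul, (h.zpow_sigma hi hj).1, h.mul_smul, L.mul_one, hx, hy, ht i hi, ht j hj]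

theorem IsExt.isDihedralResult (h : L.IsExt p s) {S : NormalSubloop L} {β γ : S.Quot}
    {t t' : S.Quot → ZMod 2} (tmul : ∀ q r, t (S.quotient.mul q r) = t q + t r)
    (tmul' : ∀ q r, t' (S.quotient.mul q r) = t' q + t' r)
    (tβ : t β = 0) (tγ : t γ = 1) (tβ' : t' β = 1) (tγ' : t' γ = 0) {K : LoopOn G}
    (hK : L.IsTwist s (fun x y => t (S.proj x) * t' (S.proj y)) K) :
    L.IsDihedralResult S 1 β γ (s 1 L.one) K := by
  have hz : ∀ t : S.Quot → ZMod 2, (∀ q r, t (S.quotient.mul q r) = t q + t r) → t β + t γ = 1 →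
      ∀ i ∈ exponentSet 1,
        t (S.quotient.zpow (S.quotient.mul β γ) i) = (i : ZMod 2) := by
    intro t ht h1 i hi
    rcases mem_exponentSet_one.1 hi with rfl | rfl
    · rw [zpow_zero, NormalSubloop.apply_one_of_map_mul S.quotient t ht, Int.cast_zero]
    · rw [zpow_one, ht, h1, Int.cast_one]
  have ht := hz t tmul (by rw [tβ, tγ, zero_add])
  have ht' := hz t' tmul' (by rw [tβ', tγ', add_zero])
  intro i hi j hj x y hx hy
  have hx : t (S.proj x) = i := by
    rcases hx with hx | hx
    · rw [hx, ht i hi]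
    · rw [hx, tmul, tβ, ht i hi, zero_add]
  have hy : t' (S.proj y) = j := by
    rcases hy with hy | hy
    · rw [hy, ht' j hj]
    · rw [hy, tmul', tγ', ht' j hj, add_zero]
  constructor
  · intro _
    rw [hK.mul, (h.zpow_sigma hi hj).1, h.mul_smul, L.mul_one, hx, hy]
  · intro _
    rw [hK.mul, (h.zpow_sigma hi hj).2, h.mul_smul, L.mul_one, hx, hy]

/-- The elements `1` and `q`, indexed by `ZMod 2`. -/
def pow2 (L : LoopOn G) (q : G) (a : ZMod 2) : G := if a = 0 then L.one else q

theorem pow2_zero (q : G) : L.pow2 q 0 = L.one := rfl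

theorem pow2_one (q : G) : L.pow2 q 1 = q := rfl

theorem pow2_add {q : G} (hq : L.mul q q = L.one) (a b : ZMod 2) :
    L.pow2 q (a + b) = L.mul (L.pow2 q a) (L.pow2 q b) := by
  rcases ZMod.two_eq_zero_or_one a with rfl | rfl <;>
    rcases ZMod.two_eq_zero_or_one b with rfl | rfl <;>
    simp [ZMod.two_add_self, pow2_zero, pow2_one, L.one_mul, L.mul_one, hq]

theorem npow_eq_one_or {q : G} (hq : L.mul q q = L.one) (n : ℕ) :
    L.npow q n = L.one ∨ L.npow q n = q := by
  induction n with
  | zero => exact Or.inl rfl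
  | succ n ih =>
    rcases ih with h | h
    · right
      rw [npow, h, L.one_mul]
    · left
      rw [npow, h, hq]

theorem zpow_eq_one_or {q : G} (hq : L.mul q q = L.one) (i : ℤ) :
    L.zpow q i = L.one ∨ L.zpow q i = q := by
  cases i with
  | ofNat n => exact npow_eq_one_or hq n
  | negSucc n =>
    rcases npow_eq_one_or hq (n + 1) with h | h
    · left
      rw [zpow, h]
      exact ldiv_eq (L.one_mul _)
    · right
      rw [zpow, h]
      exact ldiv_eq hq

namespace IsCode

variable {P : V → ZMod 2} (h : L.IsCode p s P) {S : NormalSubloop L} (hS : s 1 L.one ∈ S.carrier)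
include h hS

theorem proj_smul (a : ZMod 2) (x : G) : S.proj (s a x) = S.proj x := by
  symm
  rw [S.proj_eq_iff]
  refine ⟨s a L.one, ?_, by rw [h.mul_smul, L.mul_one]⟩
  rcases ZMod.two_eq_zero_or_one a with rfl | rfl
  · rw [h.zero_smul]
    exact S.one_mem
  · exact hS

theorem quotient_sq (q : S.Quot) : S.quotient.mul q q = S.quotient.one := by
  obtain ⟨x, rfl⟩ := S.exists_proj q
  rw [← S.proj_mul, h.sq, h.proj_smul hS, S.proj_one]

theorem quotient_comm (q r : S.Quot) : S.quotient.mul q r = S.quotient.mul r q := by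
  obtain ⟨x, rfl⟩ := S.exists_proj q
  obtain ⟨y, rfl⟩ := S.exists_proj r
  rw [← S.proj_mul, h.comm, h.proj_smul hS, S.proj_mul]

theorem quotient_assoc (q r t : S.Quot) :
    S.quotient.mul (S.quotient.mul q r) t = S.quotient.mul q (S.quotient.mul r t) := by
  obtain ⟨x, rfl⟩ := S.exists_proj q
  obtain ⟨y, rfl⟩ := S.exists_proj r
  obtain ⟨z, rfl⟩ := S.exists_proj t
  rw [← S.proj_mul, ← S.proj_mul, h.assoc, h.proj_smul hS, S.proj_mul, S.proj_mul]

theorem isBiadd_of_quotient {t t' : S.Quot → ZMod 2}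
    (ht : ∀ q r, t (S.quotient.mul q r) = t q + t r)
    (ht' : ∀ q r, t' (S.quotient.mul q r) = t' q + t' r) :
    L.IsBiadd s (fun x y => t (S.proj x) * t' (S.proj y)) :=
  ⟨fun x y z => by simp only [S.proj_mul, ht, add_mul],
    fun x y z => by simp only [S.proj_mul, ht', mul_add],
    fun c x y => by simp only [h.proj_smul hS], fun c x y => by simp only [h.proj_smul hS]⟩

/-- The generator satisfies α² = 1, so the quotient has at most two elements. -/
theorem exists_quotient_equiv_of_condC {m : ℕ} {α : S.Quot} {c : G} (hC : L.CondC S m α c) :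
    m = 1 ∧ ∃ E : S.Quot ≃ ZMod 2,
      (∀ q r, E (S.quotient.mul q r) = E q + E r) ∧ E α = 1 := by
  have hsq := h.quotient_sq hS α
  have hs : Function.Surjective (S.quotient.pow2 α) := fun q => by
    obtain ⟨i, rfl⟩ := hC.generates q
    rcases zpow_eq_one_or hsq i with h1 | h1
    · exact ⟨0, h1.symm⟩
    · exact ⟨1, h1.symm⟩
  have hcard := Nat.card_le_card_of_surjective _ hs
  rw [hC.card, Nat.card_zmod] at hcard
  have hm : m = 1 := by
    have := hC.m_pos
    omega
  have hb : Function.Bijective (S.quotient.pow2 α) := by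
    rw [Nat.bijective_iff_surjective_and_card]
    exact ⟨hs, by rw [hC.card, hm, Nat.card_zmod]⟩
  refine ⟨hm, (Equiv.ofBijective _ hb).symm, fun q r => ?_, ?_⟩
  · rw [Equiv.symm_apply_eq, Equiv.ofBijective_apply, pow2_add hsq]
    congr 1 <;> exact ((Equiv.ofBijective _ hb).apply_symm_apply _).symm
  · rw [Equiv.symm_apply_eq]
    rfl

/-- Here α² = 1 while α has order 2m, so m = 1; then β and γ serve as a basis of the four-element
quotient. -/
theorem exists_quotient_equiv_of_condD {m : ℕ} {β γ : S.Quot} {c : G} (hD : L.CondD S m β γ c) :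
    m = 1 ∧ ∃ E : S.Quot ≃ ZMod 2 × ZMod 2,
      (∀ q r, E (S.quotient.mul q r) = E q + E r) ∧ E β = (1, 0) ∧ E γ = (0, 1) := by
  have hsq := h.quotient_sq hS
  have hco := h.quotient_comm hS
  have has := h.quotient_assoc hS
  have hone : ∀ q : S.Quot, S.quotient.npow q 1 = q := fun q => S.quotient.one_mul q
  have hβ : β ≠ S.quotient.one := fun h1 =>
    hD.beta_order.2.2 1 one_pos one_lt_two ((hone β).trans h1)
  have hγ : γ ≠ S.quotient.one := fun h1 =>
    hD.gamma_order.2.2 1 one_pos one_lt_two ((hone γ).trans h1)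
  have hm := hD.m_pos
  have hα : S.quotient.mul β γ ≠ S.quotient.one := fun h1 =>
    hD.alpha_order.2.2 1 one_pos (by omega) ((hone _).trans h1)
  have hm1 : m = 1 := by
    by_contra hne
    refine hD.alpha_order.2.2 2 two_pos (by omega) ?_
    rw [npow, hone, hsq]
  subst hm1
  have hcard : Nat.card S.Quot = 4 := by
    obtain ⟨g, -⟩ := hD.dihedral
    rw [Nat.card_congr g, DihedralGroup.nat_card]
  have : Finite S.Quot := Nat.finite_of_card_ne_zero (by rw [hcard]; norm_num)
  let Φ : ZMod 2 × ZMod 2 → S.Quot := fun a =>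
    S.quotient.mul (S.quotient.pow2 β a.1) (S.quotient.pow2 γ a.2)
  have hΦ : ∀ a b, Φ (a + b) = S.quotient.mul (Φ a) (Φ b) := fun a b => by
    change S.quotient.mul (S.quotient.pow2 β (a.1 + b.1)) (S.quotient.pow2 γ (a.2 + b.2)) =
      S.quotient.mul (S.quotient.mul _ _) (S.quotient.mul _ _)
    rw [pow2_add (hsq β), pow2_add (hsq γ), has, has, ← has (S.quotient.pow2 β b.1),
      hco (S.quotient.pow2 β b.1), has (S.quotient.pow2 γ a.2)]
  have hker : ∀ a, Φ a = S.quotient.one → a = 0 := by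
    rintro ⟨a, b⟩ h1
    change S.quotient.mul (S.quotient.pow2 β a) (S.quotient.pow2 γ b) = _ at h1
    rcases ZMod.two_eq_zero_or_one a with rfl | rfl <;>
      rcases ZMod.two_eq_zero_or_one b with rfl | rfl
    · rfl
    · rw [pow2_zero, pow2_one, S.quotient.one_mul] at h1
      exact absurd h1 hγ
    · rw [pow2_zero, pow2_one, S.quotient.mul_one] at h1
      exact absurd h1 hβ
    · exact absurd h1 hα
  have hb : Function.Bijective Φ := by
    rw [Nat.bijective_iff_injective_and_card]
    refine ⟨fun a b hab => ?_, by rw [hcard, Nat.card_prod, Nat.card_zmod]⟩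
    have h1 := hker (a + b) (by rw [hΦ, hab, hsq])
    rwa [CharTwo.add_eq_zero] at h1
  refine ⟨rfl, (Equiv.ofBijective Φ hb).symm, fun q r => ?_, ?_, ?_⟩
  · rw [Equiv.symm_apply_eq, Equiv.ofBijective_apply, hΦ]
    congr 1 <;> exact ((Equiv.ofBijective Φ hb).apply_symm_apply _).symm
  · rw [Equiv.symm_apply_eq]
    exact (S.quotient.mul_one β).symm
  · rw [Equiv.symm_apply_eq]
    exact (S.quotient.one_mul γ).symm

end IsCode

/-- A nuclear element has its image in the radical, which is trivial. This pins down h in both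
constructions. -/
theorem IsCode.eq_smul_one_of_mem_nucleus {P : V → ZMod 2} (h : L.IsCode p s P)
    (hr : ∀ a, (∀ b c, polar3 P a b c = 0) → a = 0) {c : G} (hc : c ∈ L.nucleus)
    (hc1 : c ≠ L.one) : c = s 1 L.one := by
  refine h.eq_smul_one_of_ne (hr _ fun v w => ?_) hc1
  obtain ⟨x, rfl⟩ := h.surj v
  obtain ⟨y, rfl⟩ := h.surj w
  have h1 := h.assoc c x y
  rw [(hc.2 x trivial y trivial).1] at h1
  exact (h.free 0 _ _ (by rw [← h1, h.zero_smul])).symm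

theorem IsCodeLoopTrivialRadical.cyclic (hL : L.IsCodeLoopTrivialRadical) {S : NormalSubloop L}
    {m : ℕ} {α : S.Quot} {c : G} (hC : L.CondC S m α c) :
    S.quotient.IsoGroup (Multiplicative (ZMod 2)) ∧
      ∃ K : LoopOn G, L.IsCyclicResult S m α c K ∧ K.IsCodeLoopTrivialRadical ∧
        L.AssociatorEquiv K ∧ ∀ x y z, K.associator x y z = L.associator x y z := by
  obtain ⟨n, p, s, P, h, hr⟩ := isCodeLoopTrivialRadical_iff.1 hL
  obtain rfl := h.eq_smul_one_of_mem_nucleus hr hC.h_center.1 hC.h_ne_one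
  obtain ⟨rfl, E, hE, hα⟩ := h.exists_quotient_equiv_of_condC hC.h_mem hC
  obtain ⟨K, hK, hK'⟩ :=
    h.exists_isTwist_trivialRadical hr (h.isBiadd_of_quotient hC.h_mem hE hE)
  exact ⟨⟨E.trans Multiplicative.ofAdd, hE⟩, K,
    h.isCyclicResult (NormalSubloop.apply_one_of_map_mul S.quotient E hE) hα hK, hK'⟩

theorem IsCodeLoopTrivialRadical.dihedral (hL : L.IsCodeLoopTrivialRadical) {S : NormalSubloop L}
    {m : ℕ} {β γ : S.Quot} {c : G} (hD : L.CondD S m β γ c) :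
    S.quotient.IsoGroup (Multiplicative (ZMod 2 × ZMod 2)) ∧
      ∃ K : LoopOn G, L.IsDihedralResult S m β γ c K ∧ K.IsCodeLoopTrivialRadical ∧
        L.AssociatorEquiv K ∧ ∀ x y z, K.associator x y z = L.associator x y z := by
  obtain ⟨n, p, s, P, h, hr⟩ := isCodeLoopTrivialRadical_iff.1 hL
  obtain rfl := h.eq_smul_one_of_mem_nucleus hr hD.h_nucleus hD.h_ne_one
  obtain ⟨rfl, E, hE, hβ, hγ⟩ := h.exists_quotient_equiv_of_condD hD.h_mem hD
  have h1 : ∀ q r, (E (S.quotient.mul q r)).1 = (E q).1 + (E r).1 := fun q r => by rw [hE]; rfl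
  have h2 : ∀ q r, (E (S.quotient.mul q r)).2 = (E q).2 + (E r).2 := fun q r => by rw [hE]; rfl
  obtain ⟨K, hK, hK'⟩ := h.exists_isTwist_trivialRadical hr
    (h.isBiadd_of_quotient (t := fun q => (E q).2) (t' := fun q => (E q).1) hD.h_mem h2 h1)
  exact ⟨⟨E.trans Multiplicative.ofAdd, hE⟩, K,
    h.isDihedralResult (t := fun q => (E q).2) (t' := fun q => (E q).1) h2 h1 (by rw [hβ])
      (by rw [hγ]) (by rw [hβ]) (by rw [hγ]) hK, hK'⟩

end LoopOn

/-! ### Linear maps with equal ranges -/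

/-- Surjective linear maps from a finite-dimensional space to the same space differ by an
automorphism of the domain. -/
theorem LinearMap.exists_equiv_comp_eq_of_surjective {F V W : Type*} [Field F] [AddCommGroup V]
    [Module F V] [FiniteDimensional F V] [AddCommGroup W] [Module F W] {f f' : V →ₗ[F] W}
    (hf : Function.Surjective f) (hf' : Function.Surjective f') :
    ∃ e : V ≃ₗ[F] V, ∀ v, f' (e v) = f v := by
  obtain ⟨g, hg⟩ := f.exists_rightInverse_of_surjective (LinearMap.range_eq_top.2 hf)
  obtain ⟨g', hg'⟩ := f'.exists_rightInverse_of_surjective (LinearMap.range_eq_top.2 hf')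
  have hg : ∀ w, f (g w) = w := fun w => LinearMap.congr_fun hg w
  have hg' : ∀ w, f' (g' w) = w := fun w => LinearMap.congr_fun hg' w
  have h1 := f.finrank_range_add_finrank_ker
  have h2 := f'.finrank_range_add_finrank_ker
  rw [LinearMap.range_eq_top.2 hf] at h1
  rw [LinearMap.range_eq_top.2 hf'] at h2
  let κ : LinearMap.ker f ≃ₗ[F] LinearMap.ker f' := LinearEquiv.ofFinrankEq _ _ (by omega)
  let r : V →ₗ[F] LinearMap.ker f :=
    (LinearMap.id - g ∘ₗ f).codRestrict _ fun v => by simp [hg]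
  have hr : ∀ v, ((r v : LinearMap.ker f) : V) = v - g (f v) := fun v => rfl
  -- Split V as section plus kernel on each side, and match section with section by g' ∘ f and
  -- kernel with kernel by κ.
  let e : V →ₗ[F] V := g' ∘ₗ f + (LinearMap.ker f').subtype ∘ₗ κ.toLinearMap ∘ₗ r
  have he : ∀ v, e v = g' (f v) + (κ (r v) : V) := fun v => rfl
  have hfe : ∀ v, f' (e v) = f v := fun v => by
    rw [he, map_add, hg', LinearMap.mem_ker.1 (κ (r v)).2, add_zero]
  have hinj : Function.Injective e := by
    rw [← LinearMap.ker_eq_bot, LinearMap.ker_eq_bot']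
    intro v hv
    have h3 : f v = 0 := by rw [← hfe, hv, map_zero]
    rw [he, h3, map_zero, zero_add] at hv
    have h4 : r v = 0 := κ.map_eq_zero_iff.1 (Subtype.ext hv)
    have h5 := hr v
    rw [h4, h3, map_zero, sub_zero] at h5
    exact h5.symm
  exact ⟨LinearEquiv.ofInjectiveEndo e hinj, hfe⟩

theorem LinearMap.exists_equiv_comp_eq_of_range_eq {F V W : Type*} [Field F] [AddCommGroup V]
    [Module F V] [FiniteDimensional F V] [AddCommGroup W] [Module F W] {f f' : V →ₗ[F] W}
    (h : LinearMap.range f = LinearMap.range f') : ∃ e : V ≃ₗ[F] V, ∀ v, f' (e v) = f v := by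
  obtain ⟨e, he⟩ := LinearMap.exists_equiv_comp_eq_of_surjective
    (f := (LinearEquiv.ofEq _ _ h).toLinearMap ∘ₗ f.rangeRestrict) (f' := f'.rangeRestrict)
    ((LinearEquiv.ofEq _ _ h).surjective.comp f.surjective_rangeRestrict)
    f'.surjective_rangeRestrict
  exact ⟨e, fun v => congrArg Subtype.val (he v)⟩

/-! ### Splitting of symmetric alternating cocycles -/

section Cocycle

variable {V : Type w} [AddCommGroup V]

/-- The underlying set of an extension of `V` by `ZMod 2`. -/
@[ext]
structure CocycleSum (V : Type w) where
  fst : V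
  snd : ZMod 2

/-- The extension of a group of exponent two by a symmetric alternating cocycle. -/
abbrev CocycleSum.addCommGroup (h2 : ∀ v : V, v + v = 0) {μ : V → V → ZMod 2}
    (hμ : ∀ x y z, μ x y + μ (x + y) z = μ y z + μ x (y + z))
    (symm : ∀ x y, μ x y = μ y x) (self : ∀ x, μ x x = 0) : AddCommGroup (CocycleSum V) :=
  have h0 : ∀ x, μ 0 x = 0 := fun x => by
    have h := hμ 0 0 x
    rw [self, zero_add, zero_add] at h
    simpa using h
  letI : Add (CocycleSum V) := ⟨fun x y => ⟨x.fst + y.fst, x.snd + y.snd + μ x.fst y.fst⟩⟩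
  letI : Zero (CocycleSum V) := ⟨⟨0, 0⟩⟩
  letI : Neg (CocycleSum V) := ⟨id⟩
  { AddGroup.ofLeftAxioms (G := CocycleSum V)
      (fun x y z => CocycleSum.ext (add_assoc _ _ _) (by
        change x.snd + y.snd + μ x.fst y.fst + z.snd + μ (x.fst + y.fst) z.fst =
          x.snd + (y.snd + z.snd + μ y.fst z.fst) + μ x.fst (y.fst + z.fst)
        linear_combination hμ x.fst y.fst z.fst))
      (fun x => CocycleSum.ext (zero_add _) (by
        change 0 + x.snd + μ 0 x.fst = x.snd
        rw [h0, zero_add, add_zero]))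
      (fun x => CocycleSum.ext (h2 _) (by
        change x.snd + x.snd + μ x.fst x.fst = 0
        rw [self, add_zero, ZMod.two_add_self])) with
    add_comm := fun x y => CocycleSum.ext (add_comm _ _) (by
      change x.snd + y.snd + μ x.fst y.fst = y.snd + x.snd + μ y.fst x.fst
      rw [symm, add_comm x.snd]) }

/-- Symmetry makes the extension abelian and alternation gives it exponent two, so it is a vector
space over V; the second coordinate of a linear section is η. -/
theorem exists_coboundary [Module (ZMod 2) V] {μ : V → V → ZMod 2}
    (hμ : ∀ x y z, μ x y + μ (x + y) z = μ y z + μ x (y + z))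
    (symm : ∀ x y, μ x y = μ y x) (self : ∀ x, μ x x = 0) :
    ∃ η : V → ZMod 2, ∀ x y, η (x + y) = η x + η y + μ x y := by
  have h2 : ∀ v : V, v + v = 0 := fun v => by
    rw [← one_smul (ZMod 2) v, ← add_smul, ZMod.two_add_self, zero_smul]
  let _ := CocycleSum.addCommGroup h2 hμ symm self
  let _ : Module (ZMod 2) (CocycleSum V) := AddCommGroup.zmodModule fun x => by
    rw [two_nsmul]
    exact neg_add_cancel x
  let π : CocycleSum V →ₗ[ZMod 2] V :=
    AddMonoidHom.toZModLinearMap 2 ⟨⟨CocycleSum.fst, rfl⟩, fun _ _ => rfl⟩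
  obtain ⟨g, hg⟩ := π.exists_rightInverse_of_surjective
    (LinearMap.range_eq_top.2 fun v => ⟨⟨v, 0⟩, rfl⟩)
  have hg : ∀ v, (g v).fst = v := fun v => LinearMap.congr_fun hg v
  refine ⟨fun v => (g v).snd, fun x y => ?_⟩
  have h : g (x + y) = g x + g y := map_add g x y
  have h' : (g (x + y)).snd = (g x).snd + (g y).snd + μ (g x).fst (g y).fst :=
    congrArg CocycleSum.snd h
  rwa [hg, hg] at h'

end Cocycle

/-! ### The power map determines a code loop -/

namespace LoopOn

section Iso

variable {G : Type u} {H : Type v} {V : Type w} [AddCommGroup V] {L : LoopOn G} {K : LoopOn H}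
  {p : G → V} {s : ZMod 2 → G → G} {p' : H → V} {s' : ZMod 2 → H → H} {P : V → ZMod 2}

theorem IsExt.card_eq (h : L.IsExt p s) : Nat.card G = 2 * Nat.card V := by
  have hb : Function.Bijective
      (fun t : ZMod 2 × V => s t.1 (Function.surjInv h.surj t.2)) := by
    constructor
    · rintro ⟨a, v⟩ ⟨b, w⟩ hab
      have h1 := congrArg p hab
      simp only [h.map_smul, Function.surjInv_eq] at h1
      subst h1
      exact Prod.ext (h.free _ _ _ hab) rfl
    · intro x
      obtain ⟨a, ha⟩ := h.fiber (Function.surjInv h.surj (p x)) x (Function.surjInv_eq h.surj _)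
      exact ⟨(a, p x), ha.symm⟩
  rw [← Nat.card_congr (Equiv.ofBijective _ hb), Nat.card_prod, Nat.card_zmod]

/-- A code loop has a normalized section, whose cocycle is described by the power map. -/
theorem IsCode.exists_section (h : L.IsCode p s P) :
    ∃ (σ : V → G) (θ : V → V → ZMod 2), (∀ v, p (σ v) = v) ∧
      (∀ v w, L.mul (σ v) (σ w) = s (θ v w) (σ (v + w))) ∧
      (∀ v w x, θ v w + θ (v + w) x = polar3 P v w x + θ w x + θ v (w + x)) ∧
      (∀ v w, θ v w = polar P v w + θ w v) ∧ ∀ v, θ v v = P v := by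
  classical
  -- The normalization σ(0) = 1 is what turns σ(v)² into the equation θ(v, v) = P(v).
  let σ : V → G := fun v => if v = 0 then L.one else Function.surjInv h.surj v
  have h0 : σ 0 = L.one := if_pos rfl
  have hσ : ∀ v, p (σ v) = v := fun v => by
    by_cases hv : v = 0
    · rw [hv, h0, h.map_one]
    · simp only [σ, if_neg hv, Function.surjInv_eq]
  choose θ hθ using fun v w => h.fiber (σ (v + w)) (L.mul (σ v) (σ w))
    (by rw [h.map_mul, hσ, hσ, hσ])
  refine ⟨σ, θ, hσ, hθ, fun v w x => ?_, fun v w => ?_, fun v => ?_⟩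
  · have h1 := h.assoc (σ v) (σ w) (σ x)
    rw [hθ v w, hθ w x, h.smul_mul, h.mul_smul, hθ (v + w), hθ v, add_assoc, h.smul_smul,
      h.smul_smul, h.smul_smul, hσ, hσ, hσ] at h1
    rw [h.free _ _ _ h1]
  · have h1 := h.comm (σ v) (σ w)
    rw [hθ v w, hθ w v, h.smul_smul, hσ, hσ, add_comm w v] at h1
    exact h.free _ _ _ h1
  · have h1 := h.sq (σ v)
    have h2 : v + v = 0 := by
      have h3 := congrArg p h1
      rwa [h.map_mul, h.map_smul, h.map_one, hσ] at h3
    rw [hθ, h2, h0, hσ] at h1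
    exact h.free _ _ _ h1

/-- A code loop is determined by its power map. -/
theorem IsCode.iso [Module (ZMod 2) V] (h : L.IsCode p s P) (h' : K.IsCode p' s' P) :
    L.Iso K := by
  obtain ⟨σ, θ, hσ, hmul, hcoc, hsymm, hself⟩ := h.exists_section
  obtain ⟨σ', θ', hσ', hmul', hcoc', hsymm', hself'⟩ := h'.exists_section
  obtain ⟨η, hη⟩ := exists_coboundary (μ := fun v w => θ v w + θ' v w)
    (fun x y z => by
      linear_combination hcoc x y z + hcoc' x y z + ZMod.two_add_self (polar3 P x y z))
    (fun x y => by
      linear_combination hsymm x y + hsymm' x y + ZMod.two_add_self (polar P x y))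
    (fun x => by rw [hself, hself', ZMod.two_add_self])
  choose a ha using fun x => h.fiber (σ (p x)) x (hσ _)
  have hamul : ∀ x y, a (L.mul x y) = a x + a y + θ (p x) (p y) := fun x y => by
    have h1 := ha (L.mul x y)
    have h2 : L.mul x y = s (a x + a y + θ (p x) (p y)) (σ (p x + p y)) := by
      conv_lhs => rw [ha x, ha y]
      rw [h.smul_mul, h.mul_smul, hmul, h.smul_smul, h.smul_smul, add_assoc]
    conv_lhs at h1 => rw [h2]
    rw [h.map_mul] at h1
    exact (h.free _ _ _ h1).symm
  -- The element σ(v) moved by a goes to σ'(v) moved by a + η(v); the coboundary η corrects the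
  -- difference of the cocycles.
  let Φ : G → H := fun x => s' (a x + η (p x)) (σ' (p x))
  have hΦ : Function.Bijective Φ := by
    constructor
    · intro x y hxy
      have h1 := congrArg p' hxy
      simp only [Φ, h'.map_smul, hσ'] at h1
      simp only [Φ, h1] at hxy
      rw [ha x, ha y, h1, add_right_cancel (h'.free _ _ _ hxy)]
    · intro y
      obtain ⟨b, hb⟩ := h'.fiber (σ' (p' y)) y (hσ' _)
      have hpx : p (s (b + η (p' y)) (σ (p' y))) = p' y := by rw [h.map_smul, hσ]
      refine ⟨s (b + η (p' y)) (σ (p' y)), ?_⟩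
      have h1 := ha (s (b + η (p' y)) (σ (p' y)))
      rw [hpx] at h1
      simp only [Φ, hpx, ← h.free _ _ _ h1]
      conv_rhs => rw [hb]
      rw [add_assoc, ZMod.two_add_self, add_zero]
  refine ⟨Equiv.ofBijective Φ hΦ, fun x y => ?_⟩
  change s' _ _ = K.mul (s' _ _) (s' _ _)
  rw [h'.smul_mul, h'.mul_smul, hmul', h'.smul_smul, h'.smul_smul, hamul, h.map_mul, hη]
  congr 1
  linear_combination ZMod.two_add_self (θ (p x) (p y))

theorem IsCode.comp_equiv (h : L.IsCode p s P) {V' : Type*} [AddCommGroup V'] (e : V' ≃+ V) :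
    L.IsCode (fun x => e.symm (p x)) s (fun v => P (e v)) := by
  have h2 : ∀ a b, polar (fun v => P (e v)) a b = polar P (e a) (e b) := fun a b => by
    simp only [polar, map_add]
  have h3 : ∀ a b c, polar3 (fun v => P (e v)) a b c = polar3 P (e a) (e b) (e c) :=
    fun a b c => by simp only [polar3, map_add]
  refine ⟨⟨h.smul_mul, h.mul_smul, h.smul_smul, h.zero_smul, h.free,
    e.symm.surjective.comp h.surj, fun x y => by rw [h.map_mul, map_add],
    fun a x => by rw [h.map_smul], fun x y hxy => h.fiber x y (e.symm.injective hxy)⟩,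
    fun x => ?_, fun x y => ?_, fun x y z => ?_, fun a b c d => ?_⟩
  · rw [e.apply_symm_apply, h.sq]
  · rw [h2, e.apply_symm_apply, e.apply_symm_apply, h.comm]
  · rw [h3, e.apply_symm_apply, e.apply_symm_apply, e.apply_symm_apply, h.assoc]
  · rw [h3, h3, h3, map_add, h.polar3_add]

end Iso

/-! ### Twists by products of functionals as steps -/

section Steps

variable {G : Type u} {V : Type w} [AddCommGroup V] {L K : LoopOn G}
  {p : G → V} {s : ZMod 2 → G → G} {P : V → ZMod 2}

theorem IsCode.step_of_square (h : L.IsCode p s P) {a : V → ZMod 2}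
    (ha : ∀ v w, a (v + w) = a v + a w) (hs : Function.Surjective a)
    (hK : L.IsTwist s (fun x y => a (p x) * a (p y)) K) : L.Step K := by
  have hf : ∀ x y, a (p (L.mul x y)) = a (p x) + a (p y) := fun x y => by rw [h.map_mul, ha]
  obtain ⟨E, hE, hEmul⟩ :=
    NormalSubloop.exists_quotient_ker_equiv L (fun x => a (p x)) hf (hs.comp h.surj)
  have hE1 := NormalSubloop.apply_one_of_map_mul _ E hEmul
  have hS : s 1 L.one ∈ (NormalSubloop.ker L (fun x => a (p x)) hf).carrier := by
    change a (p (s 1 L.one)) = 0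
    rw [h.map_smul]
    exact NormalSubloop.apply_one_of_map_mul L (fun x => a (p x)) hf
  refine Or.inl ⟨NormalSubloop.ker L (fun x => a (p x)) hf, 1, E.symm 1, s 1 L.one,
    ⟨h.isMoufang, one_pos, h.quotient_assoc hS, fun q => ?_, ?_, h.smul_one_ne, hS,
      h.smul_one_mem_center 1⟩,
    h.isCyclicResult hE1 (E.apply_symm_apply 1) (by simpa only [hE] using hK)⟩
  · rcases ZMod.two_eq_zero_or_one (E q) with hq | hq
    · exact ⟨0, E.injective (by rw [hq, zpow_zero, hE1])⟩
    · exact ⟨1, E.injective (by rw [hq, zpow_one, E.apply_symm_apply])⟩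
  · rw [Nat.card_congr E, Nat.card_zmod]

theorem exists_equiv_dihedralGroup : ∃ g : ZMod 2 × ZMod 2 ≃ DihedralGroup (2 * 1),
    ∀ a b, g (a + b) = g a * g b := by
  change ∃ g : ZMod 2 × ZMod 2 ≃ DihedralGroup 2, ∀ a b, g (a + b) = g a * g b
  let f : ZMod 2 × ZMod 2 → DihedralGroup 2 := fun a =>
    if a.1 = 0 then DihedralGroup.r a.2 else DihedralGroup.sr a.2
  have hf : Function.Bijective f := by
    rw [Fintype.bijective_iff_injective_and_card]
    exact ⟨by decide, by decide⟩
  exact ⟨Equiv.ofBijective f hf, by change ∀ a b, f (a + b) = f a * f b; decide⟩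

theorem IsCode.step_of_product (h : L.IsCode p s P) {a b : V → ZMod 2}
    (ha : ∀ v w, a (v + w) = a v + a w) (hb : ∀ v w, b (v + w) = b v + b w)
    (hs : ∀ i j, ∃ v, a v = i ∧ b v = j)
    (hK : L.IsTwist s (fun x y => a (p x) * b (p y)) K) : L.Step K := by
  -- The order (b, a) fits β = (1, 0) and γ = (0, 1): left factors are read by a, which kills β, and
  -- right factors by b, which kills γ.
  have hf : ∀ x y, (b (p (L.mul x y)), a (p (L.mul x y))) =
      (b (p x), a (p x)) + (b (p y), a (p y)) := fun x y => by
    rw [h.map_mul, ha, hb]; rfl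
  have hquot :=
    NormalSubloop.exists_quotient_ker_equiv L (fun x => (b (p x), a (p x))) hf (by
      rintro ⟨i, j⟩
      obtain ⟨v, hv1, hv2⟩ := hs j i
      obtain ⟨x, rfl⟩ := h.surj v
      exact ⟨x, Prod.ext hv2 hv1⟩)
  set S := NormalSubloop.ker L (fun x => (b (p x), a (p x))) hf
  obtain ⟨E, hE, hEmul⟩ := hquot
  have hE1 := NormalSubloop.apply_one_of_map_mul _ E hEmul
  have hS : s 1 L.one ∈ S.carrier := by
    change (b (p (s 1 L.one)), a (p (s 1 L.one))) = 0
    rw [h.map_smul]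
    exact NormalSubloop.apply_one_of_map_mul L (fun x => (b (p x), a (p x))) hf
  have hβ : E (E.symm (1, 0)) = (1, 0) := E.apply_symm_apply _
  have hγ : E (E.symm (0, 1)) = (0, 1) := E.apply_symm_apply _
  have hα : E (S.quotient.mul (E.symm (1, 0)) (E.symm (0, 1))) = (1, 1) := by
    rw [hEmul, hβ, hγ]; rfl
  have hord : ∀ q, E q ≠ 0 → S.quotient.HasOrder q 2 := by
    intro q hq
    have h1 : S.quotient.npow q 1 = q := S.quotient.one_mul q
    refine ⟨two_pos, ?_, fun k hk0 hk2 => ?_⟩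
    · rw [npow, h1, h.quotient_sq hS]
    · obtain rfl : k = 1 := by omega
      rw [h1]
      rintro rfl
      exact hq hE1
  have hc := h.smul_one_mem_center 1
  have hmem : s 1 L.one ∈ L.dihedralG0 S 1 (E.symm (1, 0)) (E.symm (0, 1)) := by
    refine ⟨0, mem_exponentSet_one.2 (Or.inl rfl), ?_⟩
    rw [zpow_zero, h.proj_smul hS, S.proj_one]
  refine Or.inr ⟨S, 1, E.symm (1, 0), E.symm (0, 1), s 1 L.one,
    ⟨h.isMoufang, one_pos, ?_, hord _ ?_, hord _ ?_, hord _ ?_, h.smul_one_ne, hS,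
      ⟨⟨hmem, fun x _ y _ => hc.1.2 x trivial y trivial⟩, fun x _ => hc.2 x trivial⟩, hc.1, ?_⟩,
    h.isDihedralResult (t := fun q => (E q).2) (t' := fun q => (E q).1)
      (fun q r => by rw [hEmul]; rfl) (fun q r => by rw [hEmul]; rfl)
      (by rw [hβ]) (by rw [hγ]) (by rw [hβ]) (by rw [hγ]) (by simpa only [hE] using hK)⟩
  · obtain ⟨g, hg⟩ := exists_equiv_dihedralGroup
    exact ⟨E.trans g, fun q r => by
      rw [Equiv.trans_apply, hEmul, hg]; rfl⟩
  · rw [hβ]; decide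
  · rw [hγ]; decide
  · rw [hα]; decide
  -- Any x in β lies outside G₀, where a and b agree; and hxh = x because h is a central involution.
  · obtain ⟨x, hx⟩ := S.exists_proj (E.symm (1, 0))
    refine ⟨x, ?_, by rw [h.mul_smul, L.mul_one, h.smul_mul, h.smul_smul_self, L.one_mul]⟩
    rintro ⟨i, hi, hxi⟩
    rw [hx] at hxi
    have h1 := congrArg E hxi
    rw [hβ] at h1
    rcases mem_exponentSet_one.1 hi with rfl | rfl
    · rw [zpow_zero, hE1] at h1
      exact absurd h1 (by decide)
    · rw [zpow_one, hα] at h1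
      exact absurd h1 (by decide)

end Steps

/-! ### Reduction to quadratic monomials -/

section Quadratic

variable {n : ℕ}

/-- Vanishing of the third derived form makes `polar Q` bilinear, so each new coordinate adds only
monomials. Linear terms are covered since v_i = v_i² over F. -/
theorem quadratic_mem_span {Q : (Fin n → ZMod 2) → ZMod 2} (h0 : Q 0 = 0)
    (h3 : ∀ a b c, polar3 Q a b c = 0) :
    Q ∈ Submodule.span (ZMod 2) {f : (Fin n → ZMod 2) → ZMod 2 | ∃ i j, f = fun v => v i * v j} := by
  set M := Submodule.span (ZMod 2)
    {f : (Fin n → ZMod 2) → ZMod 2 | ∃ i j, f = fun v => v i * v j} with hM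
  have hadd : ∀ a b c, polar Q a (b + c) = polar Q a b + polar Q a c := fun a b c => by
    have h := h3 b c a
    rw [polar3_eq] at h
    simp only [polar] at h ⊢
    rw [add_comm a, add_comm a, add_comm a]
    linear_combination h - ZMod.two_add_self (Q (b + a) + Q b + Q a) -
      ZMod.two_add_self (Q (c + a) + Q c + Q a)
  have hzero : ∀ a, polar Q a 0 = 0 := fun a => by
    rw [polar, h0, add_zero, add_zero, ZMod.two_add_self]
  have hzero' : ∀ a, polar Q 0 a = 0 := fun a => by
    rw [polar, h0, zero_add, add_zero, ZMod.two_add_self]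
  have hmono : ∀ (c : ZMod 2) i j, (fun v : Fin n → ZMod 2 => c * (v i * v j)) ∈ M :=
    fun c i j => M.smul_mem c (Submodule.subset_span ⟨i, j, rfl⟩)
  have key : ∀ T : Finset (Fin n),
      (fun v : Fin n → ZMod 2 => Q (∑ i ∈ T, Pi.single i (v i))) ∈ M := by
    intro T
    induction T using Finset.induction_on with
    | empty =>
      simp only [Finset.sum_empty, h0]
      exact M.zero_mem
    | insert k T hk ih =>
      have hsum : ∀ v : Fin n → ZMod 2, Q (∑ i ∈ insert k T, Pi.single i (v i)) =
          Q (∑ i ∈ T, Pi.single i (v i)) + Q (Pi.single k 1) * (v k * v k) +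
            ∑ i ∈ T, polar Q (Pi.single k 1) (Pi.single i 1) * (v k * v i) := by
        intro v
        have h1 : polar Q (Pi.single k (v k)) (∑ i ∈ T, Pi.single i (v i)) =
            ∑ i ∈ T, polar Q (Pi.single k (v k)) (Pi.single i (v i)) :=
          map_sum (⟨⟨polar Q (Pi.single k (v k)), hzero _⟩, hadd _⟩ :
            (Fin n → ZMod 2) →+ ZMod 2) _ _
        have h2 : ∀ i, polar Q (Pi.single k (v k)) (Pi.single i (v i)) =
            polar Q (Pi.single k 1) (Pi.single i 1) * (v k * v i) := fun i => by
          rcases ZMod.two_eq_zero_or_one (v k) with hvk | hvk <;>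
            rcases ZMod.two_eq_zero_or_one (v i) with hvi | hvi <;>
            simp [hvk, hvi, hzero, hzero']
        have h4 : Q (Pi.single k (v k)) = Q (Pi.single k 1) * (v k * v k) := by
          rcases ZMod.two_eq_zero_or_one (v k) with hvk | hvk <;> simp [hvk, h0]
        simp only [h2] at h1
        rw [Finset.sum_insert hk, ← h1, ← h4, polar]
        linear_combination -ZMod.two_add_self (Q (Pi.single k (v k))) -
          ZMod.two_add_self (Q (∑ i ∈ T, Pi.single i (v i)))
      simp only [hsum]
      refine M.add_mem (M.add_mem ih (hmono _ k k)) ?_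
      have h5 := M.sum_mem fun i (_ : i ∈ T) =>
        hmono (polar Q (Pi.single k 1) (Pi.single i 1)) k i
      convert h5 using 1
      funext v
      simp
  have h6 := key Finset.univ
  simpa only [Finset.univ_sum_single] using h6

/-- Twisting leaves the underlying set, `p` and `s` unchanged, so the monomials can be added to the
power map one after another. -/
theorem IsCode.exists_reflTransGen {G : Type u} {p : G → Fin n → ZMod 2} {s : ZMod 2 → G → G}
    {Q : (Fin n → ZMod 2) → ZMod 2}
    (hQ : Q ∈ Submodule.span (ZMod 2)
      {f : (Fin n → ZMod 2) → ZMod 2 | ∃ i j, f = fun v => v i * v j}) :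
    ∀ {L : LoopOn G} {P : (Fin n → ZMod 2) → ZMod 2}, L.IsCode p s P →
      ∃ L', Relation.ReflTransGen LoopOn.Step L L' ∧ L'.IsCode p s (P + Q) := by
  induction hQ using Submodule.span_induction with
  | mem f hf =>
    obtain ⟨i, j, rfl⟩ := hf
    intro L P h
    have hi : ∀ i, ∀ v w : Fin n → ZMod 2, (v + w) i = v i + w i := fun i v w => rfl
    obtain ⟨K, hK⟩ := h.exists_isTwist (f := fun x y => p x i * p y j)
      ⟨fun x y z => by simp only [h.map_mul, hi, add_mul],
        fun x y z => by simp only [h.map_mul, hi, mul_add],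
        fun c x y => by simp only [h.map_smul], fun c x y => by simp only [h.map_smul]⟩
    refine ⟨K, .single ?_, h.twist (a := fun v => v i) (b := fun v => v j) (hi i) (hi j) hK⟩
    by_cases hij : i = j
    · subst hij
      exact h.step_of_square (a := fun v => v i) (hi i) (fun c => ⟨fun _ => c, rfl⟩) hK
    · refine h.step_of_product (a := fun v => v i) (b := fun v => v j) (hi i) (hi j)
        (fun c d => ⟨fun k => if k = i then c else d, by simp, ?_⟩) hK
      simp [Ne.symm hij]
  | zero =>
    intro L P h
    exact ⟨L, .refl, by rwa [add_zero]⟩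
  | add f g _ _ ihf ihg =>
    intro L P h
    obtain ⟨L₁, hL₁, h₁⟩ := ihf h
    obtain ⟨L₂, hL₂, h₂⟩ := ihg h₁
    exact ⟨L₂, hL₁.trans hL₂, by rwa [← add_assoc]⟩
  | smul c f _ ih =>
    intro L P h
    rcases ZMod.two_eq_zero_or_one c with rfl | rfl
    · exact ⟨L, .refl, by rwa [zero_smul, add_zero]⟩
    · rw [one_smul]
      exact ih h

end Quadratic

/-! ### Comparison of two code loops -/

/-- Code loops with equivalent associators have linearly equivalent third derived forms. -/
theorem IsCode.exists_equiv_polar3 {G : Type u} {H : Type v} {n : ℕ} {L : LoopOn G} {K : LoopOn H}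
    {p : G → Fin n → ZMod 2} {s : ZMod 2 → G → G} {P : (Fin n → ZMod 2) → ZMod 2}
    {p' : H → Fin n → ZMod 2} {s' : ZMod 2 → H → H} {P' : (Fin n → ZMod 2) → ZMod 2}
    (h : L.IsCode p s P) (h' : K.IsCode p' s' P') (hLK : L.AssociatorEquiv K) :
    ∃ e : (Fin n → ZMod 2) ≃ₗ[ZMod 2] (Fin n → ZMod 2),
      ∀ a b c, polar3 P' (e a) (e b) (e c) = polar3 P a b c := by
  obtain ⟨φ, c, hc, hc0, hassoc⟩ := h.exists_associator_eq hLK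
  have h1 : ∀ x y z, polar3 P' (p' (φ x)) (p' (φ y)) (p' (φ z)) =
      polar3 P (p x) (p y) (p z) := fun x y z => by
    have h2 := hassoc x y z
    rw [h'.associator_eq] at h2
    refine ZMod.eq_of_eq_zero_iff ⟨fun h3 => hc ?_, fun h3 => h'.free _ _ K.one ?_⟩
    · rw [← h2, h3, h'.zero_smul, hc0]
    · rw [h2, h3, h'.zero_smul, hc0]
  have hs' : Function.Surjective (fun x => p' (φ x)) := h'.surj.comp φ.surjective
  -- The maps v ↦ B(v, ·, ·) of the two loops, with both remaining arguments indexed by G, have the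
  -- same range although φ is not linear.
  let f : (Fin n → ZMod 2) →ₗ[ZMod 2] (G → G → ZMod 2) := AddMonoidHom.toZModLinearMap 2
    ⟨⟨fun v y z => polar3 P v (p y) (p z), by
      funext y z; exact polar3_zero_left h.power_zero _ _⟩,
      fun v w => by funext y z; exact h.polar3_add _ _ _ _⟩
  let f' : (Fin n → ZMod 2) →ₗ[ZMod 2] (G → G → ZMod 2) := AddMonoidHom.toZModLinearMap 2
    ⟨⟨fun v y z => polar3 P' v (p' (φ y)) (p' (φ z)), by
      funext y z; exact polar3_zero_left h'.power_zero _ _⟩,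
      fun v w => by funext y z; exact h'.polar3_add _ _ _ _⟩
  have hff' : ∀ x, f' (p' (φ x)) = f (p x) := fun x => by
    funext y z; exact h1 x y z
  have hrange : LinearMap.range f = LinearMap.range f' := by
    ext g
    constructor
    · rintro ⟨v, rfl⟩
      obtain ⟨x, rfl⟩ := h.surj v
      exact ⟨_, hff' x⟩
    · rintro ⟨v, rfl⟩
      obtain ⟨x, rfl⟩ := hs' v
      exact ⟨_, (hff' x).symm⟩
  obtain ⟨e, he⟩ := LinearMap.exists_equiv_comp_eq_of_range_eq hrange
  -- The vectors e(p x) and p'(φ x) may differ, but only by a radical element; rotation then allows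
  -- the replacement in all three arguments.
  have h2 : ∀ x v w, polar3 P' (e (p x)) v w = polar3 P' (p' (φ x)) v w := fun x v w => by
    obtain ⟨y, rfl⟩ := hs' v
    obtain ⟨z, rfl⟩ := hs' w
    exact congrFun (congrFun ((he (p x)).trans (hff' x).symm) y) z
  refine ⟨e, fun a b c => ?_⟩
  obtain ⟨x, rfl⟩ := h.surj a
  obtain ⟨y, rfl⟩ := h.surj b
  obtain ⟨z, rfl⟩ := h.surj c
  rw [h2, ← polar3_rotate, h2, ← polar3_rotate, h2, ← polar3_rotate, h1]

theorem IsCodeLoop.exists_reflTransGen_iso {G : Type u} {H : Type v} {L : LoopOn G}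
    {K : LoopOn H} (hL : L.IsCodeLoop) (hK : K.IsCodeLoop) (hLK : L.AssociatorEquiv K) :
    ∃ L' : LoopOn G, Relation.ReflTransGen LoopOn.Step L L' ∧ L'.Iso K := by
  obtain ⟨n, p, s, P, h⟩ := isCodeLoop_iff.1 hL
  obtain ⟨n', p', s', P', h'⟩ := isCodeLoop_iff.1 hK
  obtain rfl : n = n' := by
    have h1 := h.card_eq
    obtain ⟨φ, -⟩ := hLK
    rw [Nat.card_congr φ, h'.card_eq] at h1
    simp only [Nat.card_fun, Nat.card_zmod, Nat.card_fin] at h1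
    exact (Nat.pow_right_injective le_rfl (Nat.eq_of_mul_eq_mul_left two_pos h1)).symm
  obtain ⟨e, he⟩ := h.exists_equiv_polar3 h' hLK
  have h'' := h'.comp_equiv e.toAddEquiv
  -- In characteristic two, adding this Q to P gives P' ∘ e.
  have hQ := quadratic_mem_span (Q := P + fun v => P' (e v))
    (by
      have h1 := h.power_zero
      have h2 := h''.power_zero
      rw [Pi.add_apply, h1, zero_add]
      exact h2)
    (fun a b c => by
      have h1 := he a b c
      have h2 : polar3 (P + fun v => P' (e v)) a b c =
          polar3 P a b c + polar3 P' (e a) (e b) (e c) := by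
        simp only [polar3, Pi.add_apply, map_add]
        ring
      rw [h2, h1, ZMod.two_add_self])
  obtain ⟨L', hL', hc⟩ := IsCode.exists_reflTransGen hQ h
  refine ⟨L', hL', hc.iso (p' := fun x => e.toAddEquiv.symm (p' x)) (s' := s') ?_⟩
  convert h'' using 1
  funext v
  simp only [Pi.add_apply]
  rw [← add_assoc, ZMod.two_add_self, zero_add]
  rfl

end LoopOn

theorem theorem8p7 :
    (∀ (G : Type u) (L : LoopOn G), L.IsCodeLoopTrivialRadical →
      (∀ (S : NormalSubloop L) (m : ℕ) (α : S.Quot) (h : G), L.CondC S m α h →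
        (S.quotient.IsoGroup (Multiplicative (ZMod 2)) ∨
          S.quotient.IsoGroup (Multiplicative (ZMod 2 × ZMod 2))) ∧
        ∃ K : LoopOn G, L.IsCyclicResult S m α h K ∧ K.IsCodeLoopTrivialRadical ∧
          L.AssociatorEquiv K ∧ ∀ x y z, K.associator x y z = L.associator x y z) ∧
      (∀ (S : NormalSubloop L) (m : ℕ) (β γ : S.Quot) (h : G), L.CondD S m β γ h →
        (S.quotient.IsoGroup (Multiplicative (ZMod 2)) ∨
          S.quotient.IsoGroup (Multiplicative (ZMod 2 × ZMod 2))) ∧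
        ∃ K : LoopOn G, L.IsDihedralResult S m β γ h K ∧ K.IsCodeLoopTrivialRadical ∧
          L.AssociatorEquiv K ∧ ∀ x y z, K.associator x y z = L.associator x y z)) ∧
    (∀ (G : Type u) (H : Type v) (L : LoopOn G) (K : LoopOn H),
      L.IsCodeLoopTrivialRadical → K.IsMoufang → L.AssociatorEquiv K →
        K.IsCodeLoopTrivialRadical) ∧
    (∀ (G : Type u) (H : Type v) (L : LoopOn G) (K : LoopOn H),
      L.IsCodeLoop → K.IsCodeLoop → L.AssociatorEquiv K →
        ∃ L' : LoopOn G, Relation.ReflTransGen LoopOn.Step L L' ∧ L'.Iso K) :=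
  ⟨fun _ _ hL => ⟨fun _ _ _ _ hC => (hL.cyclic hC).imp_left Or.inl,
      fun _ _ _ _ _ hD => (hL.dihedral hD).imp_left Or.inr⟩,
    fun _ _ _ _ hL hK hLK => hL.of_associatorEquiv hK hLK,
    fun _ _ _ _ hL hK hLK => hL.exists_reflTransGen_iso hK hLK⟩
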